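/- Let $N\ge 2$, let $\mathbb H^N$ be the $N$-dimensional hyperbolic space with Riemannian gradient $\nabla_{\mathbb H^N}$ and volume element $dv_{\mathbb H^N}$, fix $x_0\in\mathbb H^N$, write $r=d(x,x_0)$ for the geodesic distance to $x_0$, $x=(r,\sigma)\in(0,\infty)\times\mathbb S^{N-1}$ for geodesic polar coordinates about $x_0$, $|\nabla_{r,\mathbb H^N}w|=|\partial w/\partial r|$ for the length of the radial part of the gradient, and $B_R=\{x: d(x,x_0)<R\}$, where $0<R\le\infty$. A pair $(A,B)$ of $C^1$ functions on $(0,R)$ is a Bessel pair on $(0,R)$ if the equation $(Ay')'+By=0$ has a positive (classical) solution $y$ on $(0,R)$. For an integer $j\ge -1$, let $\mathcal H_j(B_R\setminus\{x_0\})$ be the space of all real-valued $u\in C_c^\infty(B_R\setminus\{x_0\})$ such that $\int_{\mathbb S^{N-1}}u(r,\sigma)P(\sigma)\,d\sigma=0$ for all $r>0$ and all spherical harmonics $P$ of degree $n$, $0\le n\le j$ (so $\mathcal H_{-1}=C_c^\infty$). Theorem. Let $(r^{N-1}V,r^{N-1}W)$ be a Bessel pair on $(0,R)$ with $V\ge 0$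 on $(0,R)$, and let $f$ be a corresponding positive solution, i.e. $f>0$ and $(r^{N-1}Vf')'+r^{N-1}Wf=0$ on $(0,R)$. Then for every integer $j\ge -1$ and every $u\in\mathcal H_j(B_R\setminus\{x_0\})$ all the integrands below are integrable and $$\begin{aligned}\int_{B_R}V(r)|\nabla_{\mathbb H^N}u|^2\,dv_{\mathbb H^N}\ \ge\ &\int_{B_R}W(r)\,u^2\,dv_{\mathbb H^N}+(j+1)(N+j-1)\int_{B_R}\frac{V(r)\,u^2}{\sinh^2 r}\,dv_{\mathbb H^N}\\&+\int_{B_R}V(r)f(r)^2\Big|\nabla_{r,\mathbb H^N}\Big(\frac{u}{f(r)}\Big)\Big|^2dv_{\mathbb H^N}-(N-1)\int_{B_R}V(r)\frac{f'(r)}{f(r)}\Big(\coth r-\frac1r\Big)u^2\,dv_{\mathbb H^N}.\end{aligned}$$ -/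

import Mathlib

open MeasureTheory
open scoped RealInnerProductSpace ContDiff

noncomputable section

namespace Hyp

/-- Euclidean space `ℝ^N`. It serves as a global chart of the hyperbolic space `ℍ^N`: the point with
coordinate `y` is the point `(√(1 + |y|²), y)` of the upper sheet of the hyperboloid in Minkowski
space. All objects on `ℍ^N` below are expressed in this chart. -/
abbrev E (N : ℕ) := EuclideanSpace ℝ (Fin N)

variable {N : ℕ}

/-- The Minkowski bilinear form on `ℝ × ℝ^N`. -/
def mink (X Y : ℝ × E N) : ℝ := ⟪X.2, Y.2⟫ - X.1 * Y.1

/-- The point of the hyperboloid `{X : ⟨X, X⟩ = -1, X₀ > 0}` with coordinate `y`. -/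
def lift (y : E N) : ℝ × E N := (√(1 + ‖y‖ ^ 2), y)

/-- The hyperbolic metric: the pull-back of the Minkowski form to the hyperboloid. -/
def metric (y v w : E N) : ℝ := mink (fderiv ℝ lift y v) (fderiv ℝ lift y w)

/-- The Gram matrix `(g_{ij})` of the hyperbolic metric. -/
def gram (y : E N) : Matrix (Fin N) (Fin N) ℝ :=
  Matrix.of fun i j => metric y (EuclideanSpace.single i 1) (EuclideanSpace.single j 1)

/-- The Riemannian volume `√(det g) dy` of `ℍ^N`. -/
def vol (N : ℕ) : Measure (E N) :=
  (volume : Measure (E N)).withDensity fun y => ENNReal.ofReal √(gram y).det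

/-- The Riemannian gradient, with components `∑ⱼ g^{ij} ∂ⱼ u`. -/
def grad (u : E N → ℝ) (y : E N) : E N :=
  WithLp.toLp 2 ((gram y)⁻¹.mulVec fun j => fderiv ℝ u y (EuclideanSpace.single j 1))

/-- `|∇u|²`, the squared Riemannian length of the gradient. -/
def gradSq (u : E N → ℝ) (y : E N) : ℝ := metric y (grad u y) (grad u y)

/-- The geodesic distance of `ℍ^N`: `cosh d(x, y) = -⟨X, Y⟩`, with `⟨·, ·⟩` the Minkowski form. -/
def hdist (x y : E N) : ℝ := Real.arcosh (-mink (lift x) (lift y))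

/-- The linear isometry from Euclidean `ℝ^N` onto the tangent space of `ℍ^N` at `p` that is used to
identify the unit sphere `𝕊^{N-1}` with the unit tangent vectors at `p`. -/
def frame (p σ : E N) : E N := σ + (⟪p, σ⟫ / (1 + √(1 + ‖p‖ ^ 2))) • p

/-- Geodesic polar coordinates about the pole `p`: `t ↦ polar p t σ` is the unit speed geodesic
`t ↦ cosh t P + sinh t Σ` that starts at `p` with the direction of `σ`. -/
def polar (p : E N) (t : ℝ) (σ : E N) : E N := Real.cosh t • p + Real.sinh t • frame p σ

/-- The hyperbolic translation (Lorentz boost) that moves `0` to `p`; its inverse is `boost (-p)`. -/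
def boost (p y : E N) : E N := y + (√(1 + ‖y‖ ^ 2) + ⟪p, y⟫ / (1 + √(1 + ‖p‖ ^ 2))) • p

/-- The angular coordinate `σ ∈ 𝕊^{N-1}` of `x ≠ p` in the geodesic polar coordinates about `p`. -/
def dir (p x : E N) : E N := ‖boost (-p) x‖⁻¹ • boost (-p) x

/-- The radial derivative `∂u/∂r` in the geodesic polar coordinates about `p`. As
`∇_r u = (∂u/∂r, 0)`, one has `|∇_r u|² = (∂u/∂r)²`. -/
def radialDeriv (p : E N) (u : E N → ℝ) (x : E N) : ℝ :=
  deriv (fun t => u (polar p t (dir p x))) (hdist p x)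

/-- The open geodesic ball of radius `R ≤ ∞` about `p`. -/
def ball (p : E N) (R : EReal) : Set (E N) := {x | (hdist p x : EReal) < R}

/-- The interval `(0, R)`, for `R ≤ ∞`. -/
def interval (R : EReal) : Set ℝ := {r | 0 < r ∧ (r : EReal) < R}

/-- `y` is a (classical) positive solution of `(A y')' + B y = 0` on `(0, R)`. -/
def IsPositiveSolution (A B : ℝ → ℝ) (R : EReal) (y : ℝ → ℝ) : Prop :=
  ∀ r ∈ interval R, 0 < y r ∧ DifferentiableAt ℝ y r ∧
    HasDerivAt (fun s => A s * deriv y s) (-(B r * y r)) r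

/-- `(A, B)` is a Bessel pair on `(0, R)`. -/
def IsBesselPair (A B : ℝ → ℝ) (R : EReal) : Prop :=
  ContDiffOn ℝ 1 A (interval R) ∧ ContDiffOn ℝ 1 B (interval R) ∧
    ∃ y : ℝ → ℝ, IsPositiveSolution A B R y

/-- `P` is a homogeneous harmonic polynomial of degree `n` in `N` variables. The spherical harmonics
of degree `n` are the restrictions of these to the unit sphere. -/
def IsSolidHarmonic (n : ℕ) (P : MvPolynomial (Fin N) ℝ) : Prop :=
  P.IsHomogeneous n ∧ ∑ i, MvPolynomial.pderiv i (MvPolynomial.pderiv i P) = 0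

/-- The coefficient `∫_{𝕊^{N-1}} u(r, σ) P(σ) dσ` of `u(r, ·)` with respect to the spherical harmonic
`P`, in the geodesic polar coordinates about `p`. -/
def coeff (p : E N) (u : E N → ℝ) (P : MvPolynomial (Fin N) ℝ) (r : ℝ) : ℝ :=
  ∫ σ : Metric.sphere (0 : E N) 1,
    u (polar p r σ) * MvPolynomial.eval (fun i => (σ : E N) i) P ∂(volume : Measure (E N)).toSphere

/-- `C_c^∞(Ω)`. -/
def IsTestFunction (Ω : Set (E N)) (u : E N → ℝ) : Prop :=
  ContDiff ℝ ∞ u ∧ HasCompactSupport u ∧ tsupport u ⊆ Ω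

/-- The space `𝓗_j(Ω)` of the test functions on `Ω` whose components of degree `0, …, j` in the
expansion into spherical harmonics about `p` vanish; for `j = -1` it is `C_c^∞(Ω)`. -/
def subspaceH (p : E N) (j : ℤ) (Ω : Set (E N)) : Set (E N → ℝ) :=
  {u | IsTestFunction Ω u ∧ ∀ n : ℕ, (n : ℤ) ≤ j →
    ∀ P : MvPolynomial (Fin N) ℝ, IsSolidHarmonic n P → ∀ r : ℝ, 0 < r → coeff p u P r = 0}

end Hyp

end

/-!
The density `V |∇u|²` splits into a radial part `V (∂_r u)²` and an angular part
`V |∇_S u|² / sinh² r`, and the two parts are treated separately.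

*Radial part.* With `φ = V (f' / f) u² sinh^(N-1) r`, the equation for `f` gives, pointwise on each
geodesic ray from the pole,
`V (∂_r u)² = W u² + V f² (∂_r (u / f))² - (N-1) V (f' / f) (coth r - 1 / r) u² + sinh^(1-N) r ∂_r φ`
(`hasDerivAt_ray`), and `φ` has compact support on the ray, so that integration in polar coordinates
yields an exact identity (`integral_radialTerm`). Where `V` vanishes, the equation does not control
`f'`, which need not even be locally bounded. What the argument needs is the local integrability of
`V f'²`. It holds because `g = r^(N-1) V f'` has the continuous derivative `-r^(N-1) W f`, so that
`g f' = (g f)' - g' f ≥ 0` is, up to a continuous term, a nonnegative derivative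
(`integrableOn_mul_deriv`).

*Angular part.* On each sphere about the pole, the Poincaré inequality with the constant
`(j+1) (N+j-1)` holds for functions orthogonal to the spherical harmonics of degree at most `j`
(`sphere_poincare`). Its proof uses the rotation fields `x_i ∂_j - x_j ∂_i`: they integrate to zero
over the sphere, and half the sum of their squares is the spherical Laplacian, of which a solid
harmonic of degree `n` is an eigenvector with eigenvalue `-n (N+n-2)` (`sum_polyRot_polyRot`). Every
polynomial is on the sphere a finite sum of solid harmonics (`exists_solidHarmonic`), and polynomials
are dense by Stone–Weierstrass, so that the function can be compared with projections onto
finite-dimensional spaces of spherical harmonics.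

All of this is done for the pole `0`, with the variable `s = |x| = sinh r`. The general pole reduces
to it by a hyperbolic translation `boost p`, which is an isometry and preserves the volume
(`gradSq_comp_boost`, `measurePreserving_boost`).
-/

noncomputable section

namespace Hyp

variable {N : ℕ}

/-! ### Harmonic polynomials -/

open MvPolynomial in
/-- The Euclidean Laplacian on polynomials. -/
def lap (P : MvPolynomial (Fin N) ℝ) : MvPolynomial (Fin N) ℝ :=
  ∑ i, pderiv i (pderiv i P)

/-- The polynomial `|x|²`. -/
def normSq (N : ℕ) : MvPolynomial (Fin N) ℝ := ∑ i, MvPolynomial.X i ^ 2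

open MvPolynomial in
/-- The infinitesimal rotation `x_i ∂_j - x_j ∂_i` on polynomials. -/
def polyRot (i j : Fin N) (P : MvPolynomial (Fin N) ℝ) : MvPolynomial (Fin N) ℝ :=
  X i * pderiv j P - X j * pderiv i P

section Algebra

open MvPolynomial

theorem lap_sub (P Q : MvPolynomial (Fin N) ℝ) : lap (P - Q) = lap P - lap Q := by
  simp [lap, Finset.sum_sub_distrib]

theorem lap_C_mul (c : ℝ) (P : MvPolynomial (Fin N) ℝ) : lap (C c * P) = C c * lap P := by
  simp [lap, Finset.mul_sum]

theorem isHomogeneous_lap {n : ℕ} {P : MvPolynomial (Fin N) ℝ} (hP : P.IsHomogeneous n) :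
    (lap P).IsHomogeneous (n - 2) :=
  IsHomogeneous.sum _ _ _ fun _ _ => hP.pderiv.pderiv

theorem lap_eq_zero_of_lt_two {n : ℕ} {P : MvPolynomial (Fin N) ℝ} (hP : P.IsHomogeneous n)
    (hn : n < 2) : lap P = 0 := by
  refine Finset.sum_eq_zero fun i _ => ?_
  have h : (pderiv i P).IsHomogeneous 0 := by
    have := hP.pderiv (i := i)
    rwa [show n - 1 = 0 by omega] at this
  rw [totalDegree_eq_zero_iff_eq_C.1 ((totalDegree_zero_iff_isHomogeneous _).2 h), pderiv_C]

theorem isHomogeneous_normSq : (normSq N).IsHomogeneous 2 :=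
  IsHomogeneous.sum _ _ _ fun i _ => (isHomogeneous_X ℝ i).pow 2

theorem pderiv_normSq (i : Fin N) : pderiv i (normSq N) = C 2 * X i := by
  classical
  simp only [normSq, map_sum, pderiv_pow, pderiv_X]
  rw [Finset.sum_eq_single i]
  · simpa using (map_ofNat C 2).symm
  · intro j _ hj
    simp [hj.symm]
  · simp

theorem lap_normSq_mul {m : ℕ} {q : MvPolynomial (Fin N) ℝ} (hq : q.IsHomogeneous m) :
    lap (normSq N * q) = C (2 * N + 4 * m : ℝ) * q + normSq N * lap q := by
  have h : ∀ i, pderiv i (pderiv i (normSq N * q)) =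
      C 2 * q + C 4 * (X i * pderiv i q) + normSq N * pderiv i (pderiv i q) := by
    intro i
    simp only [pderiv_mul, pderiv_normSq, map_add, pderiv_C, pderiv_X_self]
    rw [show (C 4 : MvPolynomial (Fin N) ℝ) = C 2 + C 2 by rw [← C_add]; norm_num]
    ring
  simp only [lap, h, Finset.sum_add_distrib, ← Finset.mul_sum, hq.sum_X_mul_pderiv]
  simp only [Finset.sum_const, Finset.card_univ, Fintype.card_fin, nsmul_eq_mul, C_add, C_mul,
    map_natCast]
  ring

/-- The operator `c + |x|² Δ` with `c > 0` is onto on homogeneous polynomials of each degree. The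
inverse is found by recursion on the degree: the correction term solves an equation of the same form
with the larger constant `c + 2N + 4(m - 2)` in degree `m - 2`. -/
theorem exists_add_normSq_mul_lap_eq (m : ℕ) : ∀ (c : ℝ), 0 < c →
    ∀ s : MvPolynomial (Fin N) ℝ, s.IsHomogeneous m →
      ∃ q : MvPolynomial (Fin N) ℝ, q.IsHomogeneous m ∧ C c * q + normSq N * lap q = s := by
  induction m using Nat.strong_induction_on with
  | _ m ih =>
  intro c hc s hs
  have hcc : (C c * C c⁻¹ : MvPolynomial (Fin N) ℝ) = 1 := by
    rw [← C_mul, mul_inv_cancel₀ hc.ne', C_1]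
  by_cases hm : m < 2
  · have hq : (C c⁻¹ * s).IsHomogeneous m := by
      simpa using (isHomogeneous_C (Fin N) c⁻¹).mul hs
    refine ⟨C c⁻¹ * s, hq, ?_⟩
    rw [lap_eq_zero_of_lt_two hq hm, ← mul_assoc, hcc]
    ring
  · -- `c q + |x|² Δ q = s` for `q = (s - |x|² t) / c` is the equation `c t + Δ(|x|² t) = Δ s`
    obtain ⟨t, ht, hts⟩ := ih (m - 2) (by omega) (c + (2 * N + 4 * (m - 2 : ℕ))) (by positivity)
      (lap s) (isHomogeneous_lap hs)
    have hnt : (normSq N * t).IsHomogeneous m := by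
      have := isHomogeneous_normSq.mul ht
      rwa [show 2 + (m - 2) = m by omega] at this
    refine ⟨C c⁻¹ * (s - normSq N * t), ?_, ?_⟩
    · simpa using (isHomogeneous_C (Fin N) c⁻¹).mul (hs.sub hnt)
    · have hl : lap (normSq N * t) = lap s - C c * t := by
        rw [lap_normSq_mul ht, ← hts, C_add (a := c)]
        ring
      rw [lap_C_mul, lap_sub, hl, ← mul_assoc, hcc]
      linear_combination (normSq N * t) * hcc

/-- Every homogeneous polynomial agrees on the unit sphere with a sum of solid harmonics of degrees
at most its own. -/
theorem exists_solidHarmonic_of_isHomogeneous (n : ℕ) :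
    ∀ p : MvPolynomial (Fin N) ℝ, p.IsHomogeneous n →
      ∃ h : ℕ → MvPolynomial (Fin N) ℝ, (∀ k, IsSolidHarmonic k (h k)) ∧ (∀ k, n < k → h k = 0) ∧
        ∀ x : Fin N → ℝ, ∑ i, x i ^ 2 = 1 →
          eval x p = ∑ k ∈ Finset.range (n + 1), eval x (h k) := by
  have hz : ∀ k, IsSolidHarmonic k (0 : MvPolynomial (Fin N) ℝ) := fun k =>
    ⟨isHomogeneous_zero _ _ _, by simp⟩
  induction n using Nat.strong_induction_on with
  | _ n ih =>
  intro p hp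
  by_cases hn : n < 2
  · refine ⟨fun k => if k = n then p else 0, fun k => ?_, fun k hk => if_neg hk.ne', fun x _ => ?_⟩
    · by_cases hk : k = n
      · subst hk
        simpa using ⟨hp, lap_eq_zero_of_lt_two hp hn⟩
      · simpa [hk] using hz k
    · simp [apply_ite (eval x)]
  · rcases Nat.eq_zero_or_pos N with hN | hN
    · -- in dimension zero the unit sphere is empty
      subst hN
      exact ⟨fun _ => 0, hz, fun _ _ => rfl, fun x hx => by simp at hx⟩
    -- `q` solves `Δ(|x|² q) = Δ p`, so that `p - |x|² q` is harmonic
    obtain ⟨q, hq, hqs⟩ := exists_add_normSq_mul_lap_eq (N := N) (n - 2)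
      (2 * N + 4 * (n - 2 : ℕ)) (by positivity) (lap p) (isHomogeneous_lap hp)
    obtain ⟨h, h1, h2, h3⟩ := ih (n - 2) (by omega) q hq
    have hnq : (normSq N * q).IsHomogeneous n := by
      have := isHomogeneous_normSq.mul hq
      rwa [show 2 + (n - 2) = n by omega] at this
    have hh : IsSolidHarmonic n (p - normSq N * q) :=
      ⟨hp.sub hnq, show lap _ = 0 by rw [lap_sub, lap_normSq_mul hq, hqs, sub_self]⟩
    refine ⟨fun k => if k = n then p - normSq N * q else h k, fun k => ?_, fun k hk => ?_,
      fun x hx => ?_⟩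
    · by_cases hk : k = n
      · subst hk
        simpa using hh
      · simpa [hk] using h1 k
    · simpa [hk.ne'] using h2 k (by omega)
    · rw [Finset.sum_range_succ, Finset.sum_congr rfl (g := fun k => eval x (h k))]
      · rw [← Finset.sum_subset (Finset.range_mono (show n - 2 + 1 ≤ n by omega)), ← h3 x hx]
        · simp [normSq, hx]
        · intro k _ hk
          rw [h2 k (by simpa using hk), map_zero]
      · intro k hk
        simp [(Finset.mem_range.1 hk).ne]

/-- Every polynomial agrees on the unit sphere with a finite sum of solid harmonics. -/
theorem exists_solidHarmonic (p : MvPolynomial (Fin N) ℝ) :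
    ∃ (n : ℕ) (h : ℕ → MvPolynomial (Fin N) ℝ), (∀ k, IsSolidHarmonic k (h k)) ∧
      ∀ x : Fin N → ℝ, ∑ i, x i ^ 2 = 1 → eval x p = ∑ k ∈ Finset.range n, eval x (h k) := by
  choose h h1 h2 h3 using fun n =>
    exists_solidHarmonic_of_isHomogeneous n _ (homogeneousComponent_isHomogeneous n p)
  refine ⟨p.totalDegree + 1, fun k => ∑ n ∈ Finset.range (p.totalDegree + 1), h n k,
    fun k => ⟨IsHomogeneous.sum _ _ _ fun n _ => (h1 n k).1, ?_⟩, fun x hx => ?_⟩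
  · simp only [map_sum]
    rw [Finset.sum_comm]
    exact Finset.sum_eq_zero fun n _ => (h1 n k).2
  · conv_lhs => rw [← sum_homogeneousComponent p]
    simp only [map_sum]
    rw [Finset.sum_comm]
    refine Finset.sum_congr rfl fun n hn => ?_
    rw [h3 n x hx]
    refine Finset.sum_subset (Finset.range_mono (Finset.mem_range.1 hn)) fun k _ hk => ?_
    rw [h2 n k (by simpa using hk), map_zero]

theorem polyRot_polyRot (i j : Fin N) (P : MvPolynomial (Fin N) ℝ) :
    polyRot i j (polyRot i j P) = X i ^ 2 * pderiv j (pderiv j P) + X j ^ 2 * pderiv i (pderiv i P)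
      - X i * X j * pderiv i (pderiv j P) - X i * X j * pderiv j (pderiv i P)
      - X i * pderiv i P - X j * pderiv j P + if i = j then C 2 * (X i * pderiv i P) else 0 := by
  classical
  by_cases hij : i = j
  · subst hij
    simp only [polyRot, sub_self, map_zero, mul_zero, if_true, map_ofNat]
    ring
  · simp only [polyRot, map_sub, pderiv_mul, pderiv_X_self, pderiv_X_of_ne hij,
      pderiv_X_of_ne (Ne.symm hij), if_neg hij]
    ring

theorem pderiv_sum_X_mul (i : Fin N) (Q : Fin N → MvPolynomial (Fin N) ℝ) :
    pderiv i (∑ j, X j * Q j) = Q i + ∑ j, X j * pderiv i (Q j) := by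
  have h : ∀ j, pderiv i (X j * Q j) = (if i = j then Q j else 0) + X j * pderiv i (Q j) := by
    intro j
    by_cases hij : i = j
    · subst hij
      rw [pderiv_mul, pderiv_X_self, if_pos rfl, one_mul]
    · rw [pderiv_mul, pderiv_X_of_ne (Ne.symm hij), if_neg hij, zero_mul]
  rw [map_sum, Finset.sum_congr rfl fun j _ => h j, Finset.sum_add_distrib, Finset.sum_ite_eq,
    if_pos (Finset.mem_univ i)]

/-- The sum of the squares of the infinitesimal rotations is, up to the factor `2`, the spherical
Laplacian; a homogeneous harmonic polynomial of degree `n` is an eigenvector with eigenvalue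
`-n (N + n - 2)`. -/
theorem sum_polyRot_polyRot {n : ℕ} {P : MvPolynomial (Fin N) ℝ} (hP : IsSolidHarmonic n P) :
    ∑ i, ∑ j, polyRot i j (polyRot i j P) = C (-2 * (n * (N + n - 2)) : ℝ) * P := by
  have hE := hP.1.sum_X_mul_pderiv
  have hL : ∑ i, pderiv i (pderiv i P) = 0 := hP.2
  -- Euler's identity, differentiated once more along the radial field
  have hEE : ∑ i, ∑ j, X i * X j * pderiv i (pderiv j P) = (n : MvPolynomial (Fin N) ℝ) * n * P
      - n * P := by
    have h1 : ∀ i, X i * pderiv i (∑ j, X j * pderiv j P) =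
        X i * pderiv i P + ∑ j, X i * X j * pderiv i (pderiv j P) := by
      intro i
      rw [pderiv_sum_X_mul, mul_add, Finset.mul_sum]
      exact congrArg _ (Finset.sum_congr rfl fun j _ => by ring)
    have h2 := Finset.sum_congr rfl fun i (_ : i ∈ Finset.univ) => h1 i
    rw [Finset.sum_add_distrib, hE] at h2
    have h3 : ∑ i, X i * pderiv i (n • P) = n • n • P := by
      simp only [map_nsmul, mul_smul_comm, ← Finset.smul_sum, hE]
    rw [h3] at h2
    simp only [nsmul_eq_mul] at h2
    linear_combination -h2
  have hEE' : ∑ i, ∑ j, X i * X j * pderiv j (pderiv i P) = (n : MvPolynomial (Fin N) ℝ) * n * P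
      - n * P := by
    rw [← hEE, Finset.sum_comm]
    exact Finset.sum_congr rfl fun i _ => Finset.sum_congr rfl fun j _ => by ring
  have hE1 : ∑ i, ∑ _j : Fin N, X i * pderiv i P = (N : MvPolynomial (Fin N) ℝ) * (n * P) := by
    rw [Finset.sum_comm, Finset.sum_const, hE]
    simp
  have hE2 : ∑ _i : Fin N, ∑ j, X j * pderiv j P = (N : MvPolynomial (Fin N) ℝ) * (n * P) := by
    rw [Finset.sum_const, hE]
    simp
  have hL1 : ∑ i, ∑ j, X i ^ 2 * pderiv j (pderiv j P) = 0 := by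
    simp [← Finset.mul_sum, hL]
  have hL2 : ∑ i, ∑ j, X j ^ 2 * pderiv i (pderiv i P) = 0 := by
    rw [Finset.sum_comm]
    exact hL1
  have hD : ∑ i : Fin N, ∑ j, (if i = j then C 2 * (X i * pderiv i P) else 0) =
      C 2 * ((n : MvPolynomial (Fin N) ℝ) * P) := by
    simp only [Finset.sum_ite_eq, Finset.mem_univ, if_true, ← Finset.mul_sum, hE, nsmul_eq_mul]
  simp only [polyRot_polyRot, Finset.sum_add_distrib, Finset.sum_sub_distrib, hEE, hEE', hE1, hE2,
    hL1, hL2, hD]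
  simp only [C_mul, C_add, C_sub, C_neg, map_natCast]
  rw [map_ofNat C 2]
  ring

end Algebra

/-! ### Infinitesimal rotations and the surface measure -/

/-- The polynomial function on `E N` defined by `P`. -/
def evalE (P : MvPolynomial (Fin N) ℝ) (x : E N) : ℝ := MvPolynomial.eval (fun i => x i) P

/-- The derivative of `w` along the rotation field `x_i e_j - x_j e_i`. On the unit sphere, the sum
over `i, j` of the squares of these derivatives is `2 |∇_S w|²`. -/
def rot (i j : Fin N) (w : E N → ℝ) (x : E N) : ℝ :=
  fderiv ℝ w x (x i • EuclideanSpace.single j 1 - x j • EuclideanSpace.single i 1)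

theorem evalE_C (c : ℝ) : evalE (MvPolynomial.C c : MvPolynomial (Fin N) ℝ) = fun _ => c := by
  funext x
  simp [evalE]

theorem evalE_add (P Q : MvPolynomial (Fin N) ℝ) :
    evalE (P + Q) = fun x => evalE P x + evalE Q x := by
  funext x
  simp [evalE]

theorem evalE_mul (P Q : MvPolynomial (Fin N) ℝ) :
    evalE (P * Q) = fun x => evalE P x * evalE Q x := by
  funext x
  simp [evalE]

theorem evalE_X (i : Fin N) : evalE (MvPolynomial.X i) = (EuclideanSpace.proj i : E N →L[ℝ] ℝ) := by
  funext x
  simp [evalE]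

theorem hasFDerivAt_evalE (P : MvPolynomial (Fin N) ℝ) (x : E N) :
    HasFDerivAt (evalE P)
      (∑ i, evalE (MvPolynomial.pderiv i P) x • (EuclideanSpace.proj i : E N →L[ℝ] ℝ)) x := by
  induction P using MvPolynomial.induction_on with
  | C a =>
    rw [evalE_C]
    simpa [evalE] using hasFDerivAt_const (𝕜 := ℝ) a x
  | add p q hp hq =>
    simp only [evalE_add, map_add, add_smul, Finset.sum_add_distrib]
    exact hp.add hq
  | mul_X p n hp =>
    have h := hp.mul (EuclideanSpace.proj n : E N →L[ℝ] ℝ).hasFDerivAt (x := x)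
    rw [evalE_mul, evalE_X]
    refine h.congr_fderiv ?_
    ext v
    simp only [evalE, MvPolynomial.pderiv_mul, map_add, map_mul, MvPolynomial.eval_X, add_smul,
      Finset.sum_add_distrib, add_apply, smul_apply, sum_apply, smul_eq_mul, PiLp.proj_apply,
      Finset.mul_sum]
    rw [add_comm]
    congr 1
    · exact Finset.sum_congr rfl fun i _ => by ring
    · rw [Finset.sum_eq_single n]
      · simp
      · intro i _ hi
        simp [MvPolynomial.pderiv_X_of_ne hi.symm]
      · simp

theorem contDiff_evalE (P : MvPolynomial (Fin N) ℝ) : ContDiff ℝ 1 (evalE P) := by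
  induction P using MvPolynomial.induction_on with
  | C a =>
    rw [evalE_C]
    exact contDiff_const
  | add p q hp hq =>
    rw [evalE_add]
    exact hp.add hq
  | mul_X p n hp =>
    rw [evalE_mul, evalE_X]
    exact hp.mul (EuclideanSpace.proj n : E N →L[ℝ] ℝ).contDiff

theorem rot_evalE (i j : Fin N) (P : MvPolynomial (Fin N) ℝ) (x : E N) :
    rot i j (evalE P) x = evalE (polyRot i j P) x := by
  simp [rot, (hasFDerivAt_evalE P x).fderiv, evalE, polyRot, mul_sub, Finset.sum_sub_distrib]
  ring

theorem rot_mul (i j : Fin N) {v w : E N → ℝ} {x : E N} (hv : DifferentiableAt ℝ v x)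
    (hw : DifferentiableAt ℝ w x) :
    rot i j (fun y => v y * w y) x = v x * rot i j w x + w x * rot i j v x := by
  simp [rot, fderiv_fun_mul hv hw]

theorem continuous_rot (i j : Fin N) {w : E N → ℝ} (hw : ContDiff ℝ 1 w) :
    Continuous (rot i j w) := by
  have := hw.continuous_fderiv one_ne_zero
  unfold rot
  fun_prop

/-- The surface measure of the unit sphere. -/
abbrev sphereMeasure (N : ℕ) : Measure (Metric.sphere (0 : E N) 1) :=
  (volume : Measure (E N)).toSphere

theorem integrable_sphere {F : E N → ℝ} (hF : Continuous F) :
    Integrable (fun σ : Metric.sphere (0 : E N) 1 => F σ) (sphereMeasure N) :=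
  (hF.comp continuous_subtype_val).integrable_of_hasCompactSupport (HasCompactSupport.of_compactSpace _)

open Pointwise in
theorem integral_sphere_comp_isometry (A : E N ≃ₗᵢ[ℝ] E N) {F : E N → ℝ} (hF : Continuous F) :
    ∫ σ, F (A σ) ∂sphereMeasure N = ∫ σ, F σ ∂sphereMeasure N := by
  let φ : Metric.sphere (0 : E N) 1 → Metric.sphere (0 : E N) 1 := fun σ => ⟨A σ, by simp⟩
  have hφ : Continuous φ := by
    refine Continuous.subtype_mk ?_ _
    exact A.continuous.comp continuous_subtype_val
  have hmap : (sphereMeasure N).map φ = sphereMeasure N := by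
    ext s hs
    rw [Measure.map_apply hφ.measurable hs, Measure.toSphere_apply' _ hs,
      Measure.toSphere_apply' _ (hφ.measurable hs),
      ← A.measurePreserving.measure_preimage_emb A.toHomeomorph.measurableEmbedding
        (Set.Ioo (0 : ℝ) 1 • (Subtype.val '' s))]
    congr 2
    ext x
    simp only [Set.mem_smul, Set.mem_image, Set.mem_preimage]
    constructor
    · rintro ⟨t, ht, _, ⟨σ, hσ, rfl⟩, rfl⟩
      exact ⟨t, ht, _, ⟨φ σ, hσ, rfl⟩, by simp [φ]⟩
    · rintro ⟨t, ht, _, ⟨σ, hσ, rfl⟩, h⟩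
      refine ⟨t, ht, _, ⟨⟨A.symm σ, by simp⟩, ?_, rfl⟩, ?_⟩
      · simpa [φ] using hσ
      · apply A.injective
        simpa using h
  have := integral_map (μ := sphereMeasure N) hφ.aemeasurable
    (f := fun σ => F σ) (hF.comp continuous_subtype_val).aestronglyMeasurable
  rw [hmap] at this
  exact this.symm

/-- The rotation by the angle `θ` in the plane of the coordinates `i ≠ j`. -/
def planeRotation {i j : Fin N} (hij : i ≠ j) (θ : ℝ) : E N →ₗᵢ[ℝ] E N where
  toFun x := x + (((Real.cos θ - 1) * x i - Real.sin θ * x j) • EuclideanSpace.single i 1 +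
    (Real.sin θ * x i + (Real.cos θ - 1) * x j) • EuclideanSpace.single j 1)
  map_add' x y := by
    simp only [PiLp.add_apply]
    module
  map_smul' c x := by
    simp only [PiLp.smul_apply, smul_eq_mul, RingHom.id_apply]
    module
  norm_map' x := by
    have h : ∀ a b : ℝ, ‖x + (a • (EuclideanSpace.single i 1 : E N) +
        b • (EuclideanSpace.single j 1 : E N))‖ ^ 2 =
        ‖x‖ ^ 2 + 2 * (a * x i + b * x j) + (a ^ 2 + b ^ 2) := by
      intro a b
      rw [norm_add_sq_real, norm_add_sq_real]
      simp [inner_add_right, inner_smul_right, inner_smul_left, EuclideanSpace.inner_single_right,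
        norm_smul, hij.symm]
    rw [← sq_eq_sq₀ (norm_nonneg _) (norm_nonneg _)]
    simp only [LinearMap.coe_mk, AddHom.coe_mk]
    rw [h]
    linear_combination (x i ^ 2 + x j ^ 2) * Real.sin_sq_add_cos_sq θ

theorem planeRotation_apply {i j : Fin N} (hij : i ≠ j) (θ : ℝ) (x : E N) :
    planeRotation hij θ x = x + (((Real.cos θ - 1) * x i - Real.sin θ * x j) •
      EuclideanSpace.single i 1 +
      (Real.sin θ * x i + (Real.cos θ - 1) * x j) • EuclideanSpace.single j 1) := rfl

/-- Differentiating the invariance of the surface measure under rotations in a coordinate plane. -/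
theorem integral_rot_eq_zero (i j : Fin N) {F : E N → ℝ} (hF : ContDiff ℝ 1 F) :
    ∫ σ : Metric.sphere (0 : E N) 1, rot i j F σ ∂sphereMeasure N = 0 := by
  by_cases hij : i = j
  · subst hij
    simp [rot]
  let D : ℝ → E N → E N := fun θ x =>
    (-Real.sin θ * x i - Real.cos θ * x j) • EuclideanSpace.single i 1 +
      (Real.cos θ * x i + -Real.sin θ * x j) • EuclideanSpace.single j 1
  let F' : ℝ → E N → ℝ := fun θ x => fderiv ℝ F (planeRotation hij θ x) (D θ x)
  have hD : ∀ θ x, HasDerivAt (fun θ => planeRotation hij θ x) (D θ x) θ := by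
    intro θ x
    simp only [planeRotation_apply, D]
    refine HasDerivAt.const_add _ (HasDerivAt.add ?_ ?_)
    · exact ((((Real.hasDerivAt_cos θ).sub_const 1).mul_const (x i)).sub
        ((Real.hasDerivAt_sin θ).mul_const (x j))).smul_const _
    · exact ((((Real.hasDerivAt_sin θ).mul_const (x i))).add
        (((Real.hasDerivAt_cos θ).sub_const 1).mul_const (x j))).smul_const _
  have hF'c : Continuous (fun z : ℝ × E N => F' z.1 z.2) := by
    have := hF.continuous_fderiv one_ne_zero
    simp only [F', planeRotation_apply, D]
    fun_prop
  have hF'θ : ∀ θ, Continuous (F' θ) := fun θ => by fun_prop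
  obtain ⟨C, hC⟩ := ((isCompact_Icc (a := (-1 : ℝ)) (b := 1)).prod
    (isCompact_sphere (0 : E N) 1)).exists_bound_of_continuousOn hF'c.continuousOn
  have hmain := hasDerivAt_integral_of_dominated_loc_of_deriv_le (μ := sphereMeasure N)
    (F := fun θ (σ : Metric.sphere (0 : E N) 1) => F (planeRotation hij θ σ))
    (F' := fun θ σ => F' θ σ) (bound := fun _ => C) (x₀ := 0)
    (Icc_mem_nhds (show (-1 : ℝ) < 0 by norm_num) one_pos)
    (.of_forall fun θ =>
      (integrable_sphere (hF.continuous.comp (planeRotation hij θ).continuous)).aestronglyMeasurable)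
    (integrable_sphere (hF.continuous.comp (planeRotation hij 0).continuous))
    (integrable_sphere (hF'θ 0)).aestronglyMeasurable
    (.of_forall fun σ θ hθ => hC (θ, σ) ⟨hθ, σ.2⟩) (integrable_const C)
    (.of_forall fun σ θ _ =>
      ((hF.differentiable one_ne_zero _).hasFDerivAt.comp_hasDerivAt θ (hD θ σ)))
  have hconst : (fun θ => ∫ σ : Metric.sphere (0 : E N) 1, F (planeRotation hij θ σ)
      ∂sphereMeasure N) = fun _ => ∫ σ, F σ ∂sphereMeasure N := by
    funext θ
    exact integral_sphere_comp_isometry ((planeRotation hij θ).toLinearIsometryEquiv rfl)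
      hF.continuous
  have h0 := hmain.2
  rw [hconst] at h0
  rw [← h0.unique (hasDerivAt_const _ _)]
  refine integral_congr_ae (.of_forall fun σ => ?_)
  simp only [F', D, rot, planeRotation_apply]
  simp only [Real.cos_zero, Real.sin_zero]
  congr 1
  · simp
  · module

/-! ### The Poincaré inequality on the sphere -/

/-- `-Δ_S` on polynomials, `Δ_S` being the spherical Laplacian. -/
def sphLap (P : MvPolynomial (Fin N) ℝ) : MvPolynomial (Fin N) ℝ :=
  MvPolynomial.C (-1 / 2) * ∑ i, ∑ j, polyRot i j (polyRot i j P)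

/-- `⟨∇_S v, ∇_S w⟩` on the unit sphere. -/
def sphGrad (v w : E N → ℝ) (x : E N) : ℝ := 1 / 2 * ∑ i, ∑ j, rot i j v x * rot i j w x

theorem continuous_sphGrad {v w : E N → ℝ} (hv : ContDiff ℝ 1 v) (hw : ContDiff ℝ 1 w) :
    Continuous (sphGrad v w) := by
  have h1 := fun i j => continuous_rot i j hv
  have h2 := fun i j => continuous_rot i j hw
  unfold sphGrad
  fun_prop

theorem continuous_evalE (P : MvPolynomial (Fin N) ℝ) : Continuous (evalE P) :=
  (contDiff_evalE P).continuous

/-- Green's formula on the unit sphere, for a polynomial. -/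
theorem integral_sphGrad_evalE {v : E N → ℝ} (hv : ContDiff ℝ 1 v) (P : MvPolynomial (Fin N) ℝ) :
    ∫ σ : Metric.sphere (0 : E N) 1, sphGrad v (evalE P) σ ∂sphereMeasure N =
      ∫ σ : Metric.sphere (0 : E N) 1, v σ * evalE (sphLap P) σ ∂sphereMeasure N := by
  have hz : ∀ i j, ∫ σ : Metric.sphere (0 : E N) 1, (v σ * evalE (polyRot i j (polyRot i j P)) σ +
      rot i j v σ * rot i j (evalE P) σ) ∂sphereMeasure N = 0 := by
    intro i j
    rw [← integral_rot_eq_zero i j (hv.mul (contDiff_evalE (polyRot i j P)))]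
    refine integral_congr_ae (.of_forall fun σ => ?_)
    have := rot_mul i j (hv.differentiable one_ne_zero (σ : E N))
      ((contDiff_evalE (polyRot i j P)).differentiable one_ne_zero (σ : E N))
    simp only [rot_evalE] at this ⊢
    rw [mul_comm (rot i j v _)]
    exact this.symm
  have hI : ∀ i j, Integrable (fun σ : Metric.sphere (0 : E N) 1 =>
      v σ * evalE (polyRot i j (polyRot i j P)) σ + rot i j v σ * rot i j (evalE P) σ)
      (sphereMeasure N) := fun i j =>
    integrable_sphere (F := fun x => v x * evalE (polyRot i j (polyRot i j P)) x +
      rot i j v x * rot i j (evalE P) x)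
      ((hv.continuous.mul (continuous_evalE _)).add
        ((continuous_rot i j hv).mul (continuous_rot i j (contDiff_evalE P))))
  have hsum := integral_finsetSum (μ := sphereMeasure N) Finset.univ
    (fun i _ => integrable_finsetSum Finset.univ fun j _ => hI i j)
  simp only [integral_finsetSum Finset.univ fun j _ => hI _ j, hz, Finset.sum_const_zero] at hsum
  rw [← sub_eq_zero, ← integral_sub (integrable_sphere (continuous_sphGrad hv (contDiff_evalE P)))
    (integrable_sphere (F := fun x => v x * evalE (sphLap P) x)
      (hv.continuous.mul (continuous_evalE _)))]
  rw [← mul_zero (1 / 2 : ℝ), ← hsum, ← integral_const_mul]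
  refine integral_congr_ae (.of_forall fun σ => ?_)
  simp only [sphGrad, sphLap, Finset.sum_add_distrib, ← Finset.mul_sum]
  have : evalE (MvPolynomial.C (-1 / 2) * ∑ i, ∑ j, polyRot i j (polyRot i j P)) (σ : E N) =
      -1 / 2 * ∑ i, ∑ j, evalE (polyRot i j (polyRot i j P)) σ := by
    simp [evalE]
  rw [this]
  ring

theorem evalE_sphLap {n : ℕ} {P : MvPolynomial (Fin N) ℝ} (hP : IsSolidHarmonic n P) (x : E N) :
    evalE (sphLap P) x = n * (N + n - 2) * evalE P x := by
  simp only [sphLap, sum_polyRot_polyRot hP, evalE_mul, evalE_C]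
  ring

theorem sphGrad_comm (v w : E N → ℝ) (x : E N) : sphGrad v w x = sphGrad w v x := by
  simp only [sphGrad, mul_comm]

/-- Solid harmonics of different degrees are orthogonal on the sphere, being eigenvectors of the
spherical Laplacian with different eigenvalues. -/
theorem integral_solidHarmonic_mul_eq_zero (hN : 2 ≤ N) {k l : ℕ} (hkl : k ≠ l)
    {P Q : MvPolynomial (Fin N) ℝ} (hP : IsSolidHarmonic k P) (hQ : IsSolidHarmonic l Q) :
    ∫ σ : Metric.sphere (0 : E N) 1, evalE P σ * evalE Q σ ∂sphereMeasure N = 0 := by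
  have h1 := integral_sphGrad_evalE (contDiff_evalE P) Q
  have h2 := integral_sphGrad_evalE (contDiff_evalE Q) P
  simp only [sphGrad_comm (evalE Q), evalE_sphLap hP] at h2
  simp only [evalE_sphLap hQ] at h1
  rw [h1] at h2
  simp only [mul_left_comm _ ((_ : ℝ) * _), integral_const_mul, mul_comm (evalE Q _)] at h2
  have hN' : (2 : ℝ) ≤ N := by exact_mod_cast hN
  have h3 : ((l : ℝ) - k) * (N + l + k - 2) * ∫ σ : Metric.sphere (0 : E N) 1,
      evalE P σ * evalE Q σ ∂sphereMeasure N = 0 := by linear_combination h2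
  have h4 : ((l : ℝ) - k) ≠ 0 := sub_ne_zero.2 (by exact_mod_cast hkl.symm)
  have h5 : (0 : ℝ) < N + l + k - 2 := by
    have : (1 : ℝ) ≤ (l : ℝ) + k := by
      exact_mod_cast (show 1 ≤ l + k by omega)
    linarith
  simpa [h4, h5.ne'] using h3

/-- Polynomials are uniformly dense in the continuous functions on the sphere. -/
theorem exists_evalE_near {w : E N → ℝ} (hw : Continuous w) {δ : ℝ} (hδ : 0 < δ) :
    ∃ P : MvPolynomial (Fin N) ℝ, ∀ x : E N, ‖x‖ = 1 → |evalE P x - w x| < δ := by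
  let X : Fin N → C(E N, ℝ) := fun i => ⟨fun x => x i, by fun_prop⟩
  have hsep : (MvPolynomial.aeval X :
      MvPolynomial (Fin N) ℝ →ₐ[ℝ] C(E N, ℝ)).range.SeparatesPoints := by
    intro x y hxy
    obtain ⟨i, hi⟩ : ∃ i, x i ≠ y i := by
      by_contra! h
      exact hxy (PiLp.ext h)
    exact ⟨_, ⟨X i, ⟨MvPolynomial.X i, by simp⟩, rfl⟩, hi⟩
  obtain ⟨_, ⟨P, rfl⟩, hP⟩ :=
    ContinuousMap.exists_mem_subalgebra_near_continuous_of_isCompact_of_separatesPoints hsep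
      ⟨w, hw⟩ (isCompact_sphere (0 : E N) 1) hδ
  have hPe : ∀ x : E N, (MvPolynomial.aeval X P : C(E N, ℝ)) x = evalE P x := by
    intro x
    clear hP
    induction P using MvPolynomial.induction_on with
    | C a => simp [evalE]
    | add p q hp hq => rw [map_add, ContinuousMap.add_apply, hp, hq, evalE_add]
    | mul_X p n hp =>
      rw [map_mul, ContinuousMap.mul_apply, hp, evalE_mul, MvPolynomial.aeval_X, evalE_X]
      rfl
  refine ⟨P, fun x hx => ?_⟩
  have := hP x (by simpa using hx)
  rw [← hPe]
  exact this

/-- The Dirichlet energy of `w - Q` is nonnegative. -/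
theorem integral_sphGrad_lower_bound {w : E N → ℝ} (hw : ContDiff ℝ 1 w)
    (Q : MvPolynomial (Fin N) ℝ) :
    2 * (∫ σ : Metric.sphere (0 : E N) 1, w σ * evalE (sphLap Q) σ ∂sphereMeasure N) -
      ∫ σ : Metric.sphere (0 : E N) 1, evalE Q σ * evalE (sphLap Q) σ ∂sphereMeasure N ≤
    ∫ σ : Metric.sphere (0 : E N) 1, sphGrad w w σ ∂sphereMeasure N := by
  have hQ := contDiff_evalE Q
  rw [← integral_sphGrad_evalE hw, ← integral_sphGrad_evalE hQ, ← integral_const_mul,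
    ← integral_sub ((integrable_sphere (continuous_sphGrad hw hQ)).const_mul 2)
      (integrable_sphere (continuous_sphGrad hQ hQ))]
  refine integral_mono (((integrable_sphere (continuous_sphGrad hw hQ)).const_mul 2).sub
      (integrable_sphere (continuous_sphGrad hQ hQ))) (integrable_sphere (continuous_sphGrad hw hw))
      fun σ => ?_
  have h : 0 ≤ ∑ i, ∑ j, (rot i j w σ - rot i j (evalE Q) σ) ^ 2 := by positivity
  have h' : ∑ i, ∑ j, (rot i j w σ - rot i j (evalE Q) σ) ^ 2 =
      2 * (sphGrad w w σ - 2 * sphGrad w (evalE Q) σ + sphGrad (evalE Q) (evalE Q) σ) := by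
    have : ∀ a b : ℝ, (a - b) ^ 2 = a * a - 2 * (a * b) + b * b := fun a b => by ring
    simp only [sphGrad, this, Finset.sum_add_distrib, Finset.sum_sub_distrib, ← Finset.mul_sum]
    ring
  simp only
  linarith

/-- The Poincaré inequality on the unit sphere for functions orthogonal to all spherical harmonics of
degree at most `j`. The function is compared with its orthogonal projection onto the span of the
finitely many harmonic components of a polynomial that approximates it. -/
theorem sphere_poincare (hN : 2 ≤ N) {w : E N → ℝ} (hw : ContDiff ℝ 1 w) {j : ℤ} (hj : -1 ≤ j)
    (hwj : ∀ n : ℕ, (n : ℤ) ≤ j → ∀ P : MvPolynomial (Fin N) ℝ, IsSolidHarmonic n P →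
      ∫ σ : Metric.sphere (0 : E N) 1, w σ * evalE P σ ∂sphereMeasure N = 0) :
    ((j : ℝ) + 1) * (N + j - 1) * ∫ σ : Metric.sphere (0 : E N) 1, w σ ^ 2 ∂sphereMeasure N ≤
      ∫ σ : Metric.sphere (0 : E N) 1, sphGrad w w σ ∂sphereMeasure N := by
  have hN' : (2 : ℝ) ≤ N := by exact_mod_cast hN
  have hj' : (-1 : ℝ) ≤ j := by exact_mod_cast hj
  set lam : ℝ := ((j : ℝ) + 1) * (N + j - 1) with hlam
  have hlam0 : 0 ≤ lam := mul_nonneg (by linarith) (by linarith)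
  set S : ℝ := (sphereMeasure N).real Set.univ
  have hS : 0 ≤ S := measureReal_nonneg
  refine le_of_forall_pos_le_add fun ε hε => ?_
  -- chosen so that `lam * (δ ^ 2 * S) ≤ ε`
  set δ : ℝ := √(ε / (lam * S + 1))
  have hδ2 : δ ^ 2 = ε / (lam * S + 1) := Real.sq_sqrt (by positivity)
  obtain ⟨p, hp⟩ := exists_evalE_near hw.continuous (δ := δ) (by positivity)
  obtain ⟨n, h, hh, hph⟩ := exists_solidHarmonic p
  have hint : ∀ {u v : E N → ℝ}, Continuous u → Continuous v →
      Integrable (fun σ : Metric.sphere (0 : E N) 1 => u σ * v σ) (sphereMeasure N) :=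
    fun {u v} hu hv => integrable_sphere (F := fun x => u x * v x) (hu.mul hv)
  have hwc := hw.continuous
  have hhc : ∀ k, Continuous (evalE (h k)) := fun k => continuous_evalE _
  let α : ℕ → ℝ := fun k => ∫ σ : Metric.sphere (0 : E N) 1, w σ * evalE (h k) σ ∂sphereMeasure N
  let β : ℕ → ℝ := fun k =>
    ∫ σ : Metric.sphere (0 : E N) 1, evalE (h k) σ * evalE (h k) σ ∂sphereMeasure N
  have hβ : ∀ k, 0 ≤ β k := fun k => integral_nonneg fun σ => mul_self_nonneg _
  -- if `h k` vanishes on the sphere, then `α k = 0` too and any coefficient does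
  have hc : ∀ k, ∃ c : ℝ, c * β k = α k := by
    intro k
    by_cases hk : β k = 0
    · refine ⟨0, ?_⟩
      have h0 := (integral_eq_zero_iff_of_nonneg (fun σ => mul_self_nonneg _)
        (hint (hhc k) (hhc k))).1 hk
      rw [zero_mul]
      refine (integral_eq_zero_of_ae ?_).symm
      filter_upwards [h0] with σ hσ
      have : evalE (h k) (σ : E N) = 0 := by simpa using hσ
      simp [this]
    · exact ⟨α k / β k, div_mul_cancel₀ _ hk⟩
  -- the projection of `w` is `∑ c k • h k`
  choose c hc using hc
  have hlamk : ∀ k : ℕ, lam * (c k * α k) ≤ c k * ((k : ℝ) * (N + k - 2)) * α k := by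
    intro k
    by_cases hk : (k : ℤ) ≤ j
    · have : α k = 0 := hwj k hk (h k) (hh k)
      simp [this]
    · have h1 : ((j : ℝ) + 1) ≤ k := by exact_mod_cast (not_le.1 hk)
      have h2 : lam ≤ (k : ℝ) * (N + k - 2) :=
        mul_le_mul h1 (by linarith) (by linarith) (by linarith)
      have h3 : 0 ≤ c k * α k := by
        rw [← hc k, ← mul_assoc]
        exact mul_nonneg (mul_self_nonneg _) (hβ k)
      calc _ ≤ (k : ℝ) * (N + k - 2) * (c k * α k) := mul_le_mul_of_nonneg_right h2 h3
        _ = _ := by ring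
  -- the `L²` distance of `w` to `∑ h k`
  have hdist : ∫ σ : Metric.sphere (0 : E N) 1, (w σ - evalE p σ) * (w σ - evalE p σ)
      ∂sphereMeasure N ≤ δ ^ 2 * S := by
    have := integral_mono (μ := sphereMeasure N)
      (hint (u := fun x => w x - evalE p x) (v := fun x => w x - evalE p x)
        (hwc.sub (continuous_evalE p)) (hwc.sub (continuous_evalE p)))
      (integrable_const (δ ^ 2)) (fun σ => by
        have h1 := hp σ (by simp)
        rw [abs_sub_comm] at h1
        have h2 := sq_le_sq' (by linarith [neg_abs_le (w σ - evalE p (σ : E N))])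
          ((le_abs_self _).trans h1.le)
        simpa [sq] using h2)
    simpa [S, mul_comm] using this
  have hps : ∀ σ : Metric.sphere (0 : E N) 1, evalE p σ = ∑ k ∈ Finset.range n, evalE (h k) σ :=
    fun σ => hph _ (by
      have : ‖(σ : E N)‖ ^ 2 = 1 := by simp
      rwa [EuclideanSpace.real_norm_sq_eq] at this)
  -- sums of products of harmonics collapse to the diagonal
  have hdiag : ∀ a b : ℕ → ℝ, ∫ σ : Metric.sphere (0 : E N) 1,
      (∑ k ∈ Finset.range n, a k * evalE (h k) σ) * (∑ l ∈ Finset.range n, b l * evalE (h l) σ)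
        ∂sphereMeasure N = ∑ k ∈ Finset.range n, a k * b k * β k := by
    intro a b
    simp only [Finset.sum_mul_sum]
    rw [integral_finsetSum _ fun k _ => integrable_finsetSum _ fun l _ =>
      hint ((hhc k).const_mul (a k)) ((hhc l).const_mul (b l))]
    refine Finset.sum_congr rfl fun k hk => ?_
    rw [integral_finsetSum _ fun l _ => hint ((hhc k).const_mul (a k)) ((hhc l).const_mul (b l)),
      Finset.sum_eq_single k]
    · simp only [mul_mul_mul_comm, integral_const_mul, β]
    · intro l _ hl
      simp only [mul_mul_mul_comm, integral_const_mul,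
        integral_solidHarmonic_mul_eq_zero hN hl.symm (hh k) (hh l), mul_zero]
    · exact fun hk' => absurd hk hk'
  have hcross : ∀ a : ℕ → ℝ, ∫ σ : Metric.sphere (0 : E N) 1,
      w σ * (∑ k ∈ Finset.range n, a k * evalE (h k) σ) ∂sphereMeasure N =
        ∑ k ∈ Finset.range n, a k * α k := by
    intro a
    simp only [Finset.mul_sum]
    rw [integral_finsetSum _ fun k _ => hint hwc ((hhc k).const_mul (a k))]
    refine Finset.sum_congr rfl fun k _ => ?_
    simp only [mul_left_comm _ (a k), integral_const_mul, α]
  have hexp : ∫ σ : Metric.sphere (0 : E N) 1, (w σ - evalE p σ) * (w σ - evalE p σ)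
      ∂sphereMeasure N = (∫ σ : Metric.sphere (0 : E N) 1, w σ ^ 2 ∂sphereMeasure N) -
        2 * ∑ k ∈ Finset.range n, α k + ∑ k ∈ Finset.range n, β k := by
    have hd := hdiag (fun _ => 1) (fun _ => 1)
    have hcr := hcross (fun _ => 1)
    simp only [one_mul, ← hps] at hd hcr
    rw [← hd, ← hcr, ← integral_const_mul, ← integral_sub, ← integral_add]
    · exact integral_congr_ae (.of_forall fun σ => by ring)
    · exact (integrable_sphere (F := fun x => w x ^ 2) (hwc.pow 2)).sub
        ((hint hwc (continuous_evalE p)).const_mul 2)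
    · exact hint (continuous_evalE p) (continuous_evalE p)
    · exact integrable_sphere (F := fun x => w x ^ 2) (hwc.pow 2)
    · exact (hint hwc (continuous_evalE p)).const_mul 2
  have hw2 : ∫ σ : Metric.sphere (0 : E N) 1, w σ ^ 2 ∂sphereMeasure N ≤
      ∑ k ∈ Finset.range n, c k * α k + δ ^ 2 * S := by
    have h1 : 0 ≤ ∑ k ∈ Finset.range n, (c k - 1) ^ 2 * β k :=
      Finset.sum_nonneg fun k _ => mul_nonneg (sq_nonneg _) (hβ k)
    have h2 : ∑ k ∈ Finset.range n, (c k - 1) ^ 2 * β k = ∑ k ∈ Finset.range n, c k * α k -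
        2 * ∑ k ∈ Finset.range n, α k + ∑ k ∈ Finset.range n, β k := by
      rw [Finset.mul_sum, ← Finset.sum_sub_distrib, ← Finset.sum_add_distrib]
      refine Finset.sum_congr rfl fun k _ => ?_
      rw [← hc k]
      ring
    rw [hexp] at hdist
    linarith
  -- the Dirichlet energy of the projection
  have henergy : ∑ k ∈ Finset.range n, c k * ((k : ℝ) * (N + k - 2)) * α k ≤
      ∫ σ : Metric.sphere (0 : E N) 1, sphGrad w w σ ∂sphereMeasure N := by
    have h1 := integral_sphGrad_lower_bound hw
      (∑ k ∈ Finset.range n, MvPolynomial.C (c k) * h k)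
    have h2 : ∀ x : E N, evalE (∑ k ∈ Finset.range n, MvPolynomial.C (c k) * h k) x =
        ∑ k ∈ Finset.range n, c k * evalE (h k) x := fun x => by simp [evalE]
    have h3 : ∀ x : E N, evalE (sphLap (∑ k ∈ Finset.range n, MvPolynomial.C (c k) * h k)) x =
        ∑ k ∈ Finset.range n, (c k * ((k : ℝ) * (N + k - 2))) * evalE (h k) x := by
      intro x
      have h4 : sphLap (∑ k ∈ Finset.range n, MvPolynomial.C (c k) * h k) =
          ∑ k ∈ Finset.range n, MvPolynomial.C (c k) * sphLap (h k) := by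
        have h5 : ∀ (i j : Fin N) (P : ℕ → MvPolynomial (Fin N) ℝ),
            polyRot i j (∑ k ∈ Finset.range n, MvPolynomial.C (c k) * P k) =
              ∑ k ∈ Finset.range n, MvPolynomial.C (c k) * polyRot i j (P k) := by
          intro i j P
          simp only [polyRot, map_sum, MvPolynomial.pderiv_C_mul, Finset.mul_sum,
            ← Finset.sum_sub_distrib]
          exact Finset.sum_congr rfl fun k _ => by ring
        simp only [sphLap, h5]
        rw [Finset.sum_congr rfl fun i _ => Finset.sum_comm, Finset.sum_comm]
        simp only [← Finset.mul_sum]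
        rw [Finset.mul_sum]
        exact Finset.sum_congr rfl fun k _ => by ring
      have h6 : evalE (∑ k ∈ Finset.range n, MvPolynomial.C (c k) * sphLap (h k)) x =
          ∑ k ∈ Finset.range n, c k * evalE (sphLap (h k)) x := by simp [evalE]
      rw [h4, h6]
      refine Finset.sum_congr rfl fun k _ => ?_
      rw [evalE_sphLap (hh k)]
      ring
    simp only [h2, h3] at h1
    rw [hcross, hdiag] at h1
    have h7 : ∑ k ∈ Finset.range n, c k * (c k * ((k : ℝ) * (N + k - 2))) * β k =
        ∑ k ∈ Finset.range n, c k * ((k : ℝ) * (N + k - 2)) * α k := by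
      refine Finset.sum_congr rfl fun k _ => ?_
      rw [← hc k]
      ring
    rw [h7] at h1
    linarith
  have hfin : lam * (δ ^ 2 * S) ≤ ε := by
    rw [hδ2]
    have : lam * (ε / (lam * S + 1) * S) = ε * (lam * S / (lam * S + 1)) := by ring
    rw [this]
    refine mul_le_of_le_one_right hε.le ?_
    rw [div_le_one (by positivity)]
    linarith
  calc lam * ∫ σ : Metric.sphere (0 : E N) 1, w σ ^ 2 ∂sphereMeasure N
      ≤ lam * (∑ k ∈ Finset.range n, c k * α k + δ ^ 2 * S) := mul_le_mul_of_nonneg_left hw2 hlam0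
    _ = ∑ k ∈ Finset.range n, lam * (c k * α k) + lam * (δ ^ 2 * S) := by
      rw [mul_add, Finset.mul_sum]
    _ ≤ _ := add_le_add ((Finset.sum_le_sum fun k _ => hlamk k).trans henergy) hfin

/-! ### The hyperboloid model and its translations -/

/-- The time coordinate `√(1 + |y|²) = cosh d(0, y)` of the point `lift y` of the hyperboloid. -/
def height (y : E N) : ℝ := √(1 + ‖y‖ ^ 2)

theorem height_sq (y : E N) : height y ^ 2 = 1 + ‖y‖ ^ 2 := Real.sq_sqrt (by positivity)

theorem height_pos (y : E N) : 0 < height y := Real.sqrt_pos.2 (by positivity)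

theorem norm_le_height (y : E N) : ‖y‖ ≤ height y :=
  Real.le_sqrt_of_sq_le (by linarith)

theorem height_neg (y : E N) : height (-y) = height y := by simp [height]

theorem contDiff_height : ContDiff ℝ ∞ (height : E N → ℝ) :=
  (contDiff_const.add (contDiff_norm_sq ℝ)).sqrt fun y => by positivity

theorem hasFDerivAt_height (y : E N) :
    HasFDerivAt height ((height y)⁻¹ • innerSL ℝ y) y := by
  have h := ((hasStrictFDerivAt_norm_sq y).hasFDerivAt.const_add 1).sqrt
    (by positivity : (1 : ℝ) + ‖y‖ ^ 2 ≠ 0)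
  refine h.congr_fderiv ?_
  ext v
  simp [height]
  ring

theorem fderiv_lift (y v : E N) : fderiv ℝ lift y v = ((height y)⁻¹ * ⟪y, v⟫, v) := by
  have h : HasFDerivAt lift (((height y)⁻¹ • innerSL ℝ y).prod (ContinuousLinearMap.id ℝ (E N))) y :=
    (hasFDerivAt_height y).prodMk (hasFDerivAt_id y)
  rw [h.fderiv]
  simp

theorem metric_eq (y v w : E N) :
    metric y v w = ⟪v, w⟫ - ⟪y, v⟫ * ⟪y, w⟫ / (1 + ‖y‖ ^ 2) := by
  have h := height_pos y
  simp only [metric, mink, fderiv_lift, ← height_sq]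
  field_simp

theorem metric_comm (y v w : E N) : metric y v w = metric y w v := by
  rw [metric_eq, metric_eq, real_inner_comm, mul_comm]

open Matrix in
theorem gram_eq (y : E N) :
    gram y = 1 + replicateCol Unit (fun i => -y i / (1 + ‖y‖ ^ 2)) * replicateRow Unit (fun i => y i) := by
  ext i j
  rcases eq_or_ne i j with rfl | h
  · simp [gram, metric_eq, EuclideanSpace.inner_single_right, Matrix.mul_apply]
    ring
  · simp [gram, metric_eq, EuclideanSpace.inner_single_right, Matrix.mul_apply, h, h.symm]
    ring

theorem sum_mul_self_eq (y : E N) : ∑ i, y i * y i = ‖y‖ ^ 2 := by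
  rw [EuclideanSpace.real_norm_sq_eq]
  exact Finset.sum_congr rfl fun i _ => (sq _).symm

theorem det_gram (y : E N) : (gram y).det = (1 + ‖y‖ ^ 2)⁻¹ := by
  rw [gram_eq, Matrix.det_one_add_replicateCol_mul_replicateRow]
  have h : (1 : ℝ) + ‖y‖ ^ 2 ≠ 0 := by positivity
  have h2 : (fun i => y i) ⬝ᵥ (fun i => -y i / (1 + ‖y‖ ^ 2)) = -‖y‖ ^ 2 / (1 + ‖y‖ ^ 2) := by
    simp only [dotProduct, ← sum_mul_self_eq y, ← Finset.sum_neg_distrib, Finset.sum_div]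
    exact Finset.sum_congr rfl fun i _ => by ring
  rw [h2]
  field_simp
  ring

theorem inv_gram (y : E N) : (gram y)⁻¹ = 1 + Matrix.vecMulVec (fun i => y i) (fun i => y i) := by
  refine Matrix.inv_eq_right_inv ?_
  have h : (1 : ℝ) + ‖y‖ ^ 2 ≠ 0 := by positivity
  ext i j
  have h2 : ∑ k, -(y i * y k) / (1 + ‖y‖ ^ 2) * (y k * y j) =
      -(y i * y j) * ‖y‖ ^ 2 / (1 + ‖y‖ ^ 2) := by
    rw [← sum_mul_self_eq y]
    simp only [Finset.mul_sum, Finset.sum_div]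
    exact Finset.sum_congr rfl fun k _ => by ring
  have h3 : gram y = 1 + Matrix.of fun i j => -(y i * y j) / (1 + ‖y‖ ^ 2) := by
    rw [gram_eq]
    ext i j
    simp [Matrix.mul_apply]
    ring
  rw [h3, mul_add, add_mul, add_mul]
  simp only [mul_one, one_mul, Matrix.add_apply, Matrix.mul_apply, Matrix.of_apply,
    Matrix.vecMulVec_apply, h2]
  field_simp
  ring

theorem sum_coord_mul_fderiv (u : E N → ℝ) (y v : E N) :
    ∑ i, v i * fderiv ℝ u y (EuclideanSpace.single i 1) = fderiv ℝ u y v := by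
  conv_rhs => rw [← (EuclideanSpace.basisFun (Fin N) ℝ).sum_repr v]
  simp [map_sum]

theorem grad_apply (u : E N → ℝ) (y : E N) (i : Fin N) :
    grad u y i = fderiv ℝ u y (EuclideanSpace.single i 1) + y i * fderiv ℝ u y y := by
  simp only [grad, inv_gram, Matrix.add_mulVec, Matrix.one_mulVec, Pi.add_apply]
  rw [← sum_coord_mul_fderiv u y y]
  simp [Matrix.mulVec, dotProduct, Matrix.vecMulVec_apply, Finset.mul_sum, mul_assoc]

theorem metric_grad (u : E N → ℝ) (y w : E N) : metric y (grad u y) w = fderiv ℝ u y w := by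
  have h : (1 : ℝ) + ‖y‖ ^ 2 ≠ 0 := by positivity
  have h1 : ∀ w : E N, ⟪grad u y, w⟫ = fderiv ℝ u y w + fderiv ℝ u y y * ⟪y, w⟫ := by
    intro w
    rw [← sum_coord_mul_fderiv u y w]
    simp only [PiLp.inner_apply, grad_apply, RCLike.inner_apply, conj_trivial, Finset.mul_sum,
      ← Finset.sum_add_distrib]
    exact Finset.sum_congr rfl fun i _ => by ring
  rw [metric_eq, real_inner_comm _ y, h1, h1, real_inner_self_eq_norm_sq]
  field_simp
  ring

theorem gradSq_eq (u : E N → ℝ) (y : E N) :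
    gradSq u y = ∑ i, fderiv ℝ u y (EuclideanSpace.single i 1) ^ 2 + fderiv ℝ u y y ^ 2 := by
  rw [gradSq, metric_grad, ← sum_coord_mul_fderiv u y (grad u y)]
  simp only [grad_apply, add_mul, Finset.sum_add_distrib]
  have : ∑ i, y i * fderiv ℝ u y y * fderiv ℝ u y (EuclideanSpace.single i 1) =
      fderiv ℝ u y y * ∑ i, y i * fderiv ℝ u y (EuclideanSpace.single i 1) := by
    rw [Finset.mul_sum]
    exact Finset.sum_congr rfl fun i _ => by ring
  rw [this, sum_coord_mul_fderiv]
  simp only [sq]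

theorem vol_eq : vol N = (volume : Measure (E N)).withDensity fun y => ENNReal.ofReal (height y)⁻¹ := by
  unfold vol
  congr 1
  funext y
  rw [det_gram, Real.sqrt_inv]
  rfl

/-! ### Hyperbolic translations -/

theorem boost_eq (p y : E N) : boost p y = y + (height y + ⟪p, y⟫ / (1 + height p)) • p := rfl

theorem height_boost (p y : E N) : height (boost p y) = height p * height y + ⟪p, y⟫ := by
  have hp := height_pos p
  have hy := height_pos y
  have h0 : 0 ≤ height p * height y + ⟪p, y⟫ := by
    have h1 := neg_le_of_abs_le (abs_real_inner_le_norm p y)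
    have h2 := mul_le_mul (norm_le_height p) (norm_le_height y) (norm_nonneg _) hp.le
    linarith
  rw [← sq_eq_sq₀ (height_pos _).le h0, height_sq, boost_eq, norm_add_sq_real, norm_smul,
    real_inner_smul_right, real_inner_comm, mul_pow, Real.norm_eq_abs, sq_abs]
  have h1 : ‖p‖ ^ 2 = height p ^ 2 - 1 := by rw [height_sq]; ring
  have h2 : ‖y‖ ^ 2 = height y ^ 2 - 1 := by rw [height_sq]; ring
  rw [h1, h2]
  field_simp
  ring

theorem boost_neg_boost (p y : E N) : boost (-p) (boost p y) = y := by
  have hp := height_pos p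
  have h1 : ‖p‖ ^ 2 = height p ^ 2 - 1 := by rw [height_sq]; ring
  have h : height (boost p y) + ⟪-p, boost p y⟫ / (1 + height (-p)) =
      height y + ⟪p, y⟫ / (1 + height p) := by
    rw [height_boost, height_neg, boost_eq, inner_neg_left, inner_add_right, real_inner_smul_right,
      real_inner_self_eq_norm_sq, h1]
    field_simp
    ring
  rw [boost_eq (-p), h, boost_eq p]
  module

theorem contDiff_boost (p : E N) : ContDiff ℝ ∞ (boost p) := by
  have h : ContDiff ℝ ∞ (fun y : E N => ⟪p, y⟫) := contDiff_const.inner ℝ contDiff_id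
  exact contDiff_id.add ((contDiff_height.add (h.div_const _)).smul contDiff_const)

/-- The hyperbolic translation from `0` to `p`, as a homeomorphism. -/
def boostHomeo (p : E N) : E N ≃ₜ E N where
  toFun := boost p
  invFun := boost (-p)
  left_inv := boost_neg_boost p
  right_inv y := by simpa using boost_neg_boost (-p) y
  continuous_toFun := (contDiff_boost p).continuous
  continuous_invFun := (contDiff_boost (-p)).continuous

/-- The derivative of `boost p` at `y`. -/
def boostDeriv (p y : E N) : E N →L[ℝ] E N :=
  ContinuousLinearMap.id ℝ (E N) +
    ((height y)⁻¹ • innerSL ℝ y + (1 + height p)⁻¹ • innerSL ℝ p).smulRight p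

theorem boostDeriv_apply (p y v : E N) :
    boostDeriv p y v = v + ((height y)⁻¹ * ⟪y, v⟫ + (1 + height p)⁻¹ * ⟪p, v⟫) • p := by
  simp [boostDeriv]

theorem hasFDerivAt_boost (p y : E N) : HasFDerivAt (boost p) (boostDeriv p y) y := by
  have h1 : HasFDerivAt (fun y : E N => ⟪p, y⟫ / (1 + height p)) ((1 + height p)⁻¹ • innerSL ℝ p) y := by
    simp only [div_eq_inv_mul]
    exact ((innerSL ℝ p).hasFDerivAt (x := y)).const_mul _
  exact (hasFDerivAt_id y).add (((hasFDerivAt_height y).add h1).smul_const p)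

theorem det_boostDeriv (p y : E N) :
    (boostDeriv p y).det = height (boost p y) / height y := by
  have hp := height_pos p
  have hy := height_pos y
  have h : ((boostDeriv p y : E N →L[ℝ] E N) : E N →ₗ[ℝ] E N) = LinearMap.transvection
      (((height y)⁻¹ • innerSL ℝ y + (1 + height p)⁻¹ • innerSL ℝ p : E N →L[ℝ] ℝ) : E N →ₗ[ℝ] ℝ)
      p := by
    ext v
    simp [boostDeriv, LinearMap.transvection.apply]
  have h1 : ‖p‖ ^ 2 = height p ^ 2 - 1 := by rw [height_sq]; ring
  rw [ContinuousLinearMap.det, h, LinearMap.transvection.det, height_boost]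
  simp only [ContinuousLinearMap.coe_coe, add_apply, smul_apply, innerSL_apply_apply, smul_eq_mul,
    real_inner_self_eq_norm_sq, h1, real_inner_comm y p]
  field_simp
  ring

/-- `boost p` is an isometry. -/
theorem metric_boost (p y v w : E N) :
    metric (boost p y) (boostDeriv p y v) (boostDeriv p y w) = metric y v w := by
  have hp := height_pos p
  have hy := height_pos y
  have hb := height_pos (boost p y)
  have h1 : ‖p‖ ^ 2 = height p ^ 2 - 1 := by rw [height_sq]; ring
  have h2 : ‖y‖ ^ 2 = height y ^ 2 - 1 := by rw [height_sq]; ring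
  have key : ∀ v : E N, ⟪boost p y, boostDeriv p y v⟫ =
      height (boost p y) * (height p * ((height y)⁻¹ * ⟪y, v⟫) + ⟪p, v⟫) := by
    intro v
    rw [height_boost, boost_eq, boostDeriv_apply, inner_add_right, inner_add_left, inner_add_left,
      real_inner_smul_right, real_inner_smul_right, real_inner_smul_left, real_inner_smul_left,
      real_inner_self_eq_norm_sq, h1, real_inner_comm p y]
    field_simp
    ring
  rw [metric_eq, metric_eq, ← height_sq, ← height_sq, key, key, boostDeriv_apply, boostDeriv_apply,
    inner_add_right, inner_add_left, inner_add_left, real_inner_smul_right, real_inner_smul_right,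
    real_inner_smul_left, real_inner_smul_left, real_inner_self_eq_norm_sq, h1,
    real_inner_comm p v]
  field_simp
  ring

theorem boostDeriv_surjective (p y : E N) : Function.Surjective (boostDeriv p y) := by
  have hy := height_pos y
  have hb := height_pos (boost p y)
  have h : IsUnit (LinearMap.det (boostDeriv p y : E N →ₗ[ℝ] E N)) := by
    have := det_boostDeriv p y
    rw [ContinuousLinearMap.det] at this
    rw [this]
    exact (div_ne_zero hb.ne' hy.ne').isUnit
  exact ((boostDeriv p y : E N →ₗ[ℝ] E N).equivOfDetNeZero h.ne_zero).surjective

/-- The gradients correspond under the isometry, because they represent the differentials. -/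
theorem gradSq_comp_boost (p : E N) {u : E N → ℝ} (hu : Differentiable ℝ u) (y : E N) :
    gradSq (fun z => u (boost p z)) y = gradSq u (boost p y) := by
  have hd : ∀ v, fderiv ℝ (fun z => u (boost p z)) y v =
      fderiv ℝ u (boost p y) (boostDeriv p y v) := fun v => by
    have := (hu (boost p y)).hasFDerivAt.comp y (hasFDerivAt_boost p y)
    rw [show (fun z => u (boost p z)) = u ∘ boost p from rfl, this.fderiv]
    rfl
  obtain ⟨g, hg⟩ := boostDeriv_surjective p y (grad u (boost p y))
  rw [gradSq, gradSq, metric_grad, metric_grad, hd, ← metric_grad u, ← hg, metric_boost, metric_comm,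
    metric_grad, hd]

/-- The Jacobian of `boost p` is the quotient of the two values of `height`, and `vol` has the density
`1 / height`. -/
theorem measurePreserving_boost (p : E N) : MeasurePreserving (boost p) (vol N) (vol N) := by
  refine ⟨(boostHomeo p).continuous.measurable, ?_⟩
  ext s hs
  have hs' : MeasurableSet (boost p ⁻¹' s) := (boostHomeo p).continuous.measurable hs
  rw [Measure.map_apply (contDiff_boost p).continuous.measurable hs, vol_eq, withDensity_apply _ hs,
    withDensity_apply _ hs']
  have hs'' : s = boost p '' (boost p ⁻¹' s) :=
    (Set.image_preimage_eq s (boostHomeo p).surjective).symm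
  conv_rhs => rw [hs'']
  rw [lintegral_image_eq_lintegral_abs_det_fderiv_mul volume hs'
    (fun x _ => (hasFDerivAt_boost p x).hasFDerivWithinAt) (boostHomeo p).injective.injOn]
  refine lintegral_congr_ae (.of_forall fun y => ?_)
  have hy := height_pos y
  have hb := height_pos (boost p y)
  simp only
  rw [det_boostDeriv, abs_of_pos (by positivity), ← ENNReal.ofReal_mul (by positivity)]
  congr 1
  field_simp

theorem hdist_eq (x y : E N) : hdist x y = Real.arcosh (height x * height y - ⟪x, y⟫) := by
  simp only [hdist, mink, lift, height, neg_sub]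

theorem hdist_zero (y : E N) : hdist 0 y = Real.arsinh ‖y‖ := by
  have h : height y = Real.cosh (Real.arsinh ‖y‖) := by rw [Real.cosh_arsinh]; rfl
  rw [hdist_eq, inner_zero_left, sub_zero, show height (0 : E N) = 1 by simp [height], one_mul, h,
    Real.arcosh_cosh (Real.arsinh_nonneg_iff.2 (norm_nonneg _))]

theorem hdist_boost (p y : E N) : hdist p (boost p y) = hdist 0 y := by
  have hp := height_pos p
  have h1 : ‖p‖ ^ 2 = height p ^ 2 - 1 := by rw [height_sq]; ring
  rw [hdist_eq, hdist_eq, height_boost, boost_eq, inner_add_right, real_inner_smul_right,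
    real_inner_self_eq_norm_sq, h1, inner_zero_left, show height (0 : E N) = 1 by simp [height]]
  congr 1
  field_simp
  ring

theorem polar_eq_boost (p : E N) (t : ℝ) {σ : E N} (hσ : ‖σ‖ = 1) :
    polar p t σ = boost p (Real.sinh t • σ) := by
  have h : height (Real.sinh t • σ) = Real.cosh t := by
    rw [height, norm_smul, hσ, mul_one, Real.norm_eq_abs, sq_abs, add_comm, ← Real.cosh_sq,
      Real.sqrt_sq (Real.cosh_pos t).le]
  rw [boost_eq, h, polar, frame, real_inner_smul_right]
  change Real.cosh t • p + Real.sinh t • (σ + (⟪p, σ⟫ / (1 + height p)) • p) = _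
  module

theorem boost_zero (y : E N) : boost 0 y = y := by simp [boost_eq]

theorem polar_zero (t : ℝ) (σ : E N) : polar 0 t σ = Real.sinh t • σ := by simp [polar, frame]

theorem dir_boost (p y : E N) : dir p (boost p y) = ‖y‖⁻¹ • y := by
  rw [dir, boost_neg_boost]

/-! ### Polar coordinates and one-dimensional integrability -/

theorem measurable_height_inv : Measurable fun y : E N => ENNReal.ofReal (height y)⁻¹ :=
  (contDiff_height.continuous.measurable.inv).ennreal_ofReal

theorem integrable_vol_iff {T : E N → ℝ} :
    Integrable T (vol N) ↔ Integrable (fun x => (height x)⁻¹ * T x) volume := by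
  rw [vol_eq, integrable_withDensity_iff_integrable_smul' measurable_height_inv
    (.of_forall fun _ => ENNReal.ofReal_lt_top)]
  have h : ∀ x : E N, 0 ≤ (height x)⁻¹ := fun x => (inv_pos.2 (height_pos x)).le
  simp only [smul_eq_mul, ENNReal.toReal_ofReal (h _)]

theorem integral_vol (T : E N → ℝ) : ∫ x, T x ∂vol N = ∫ x, (height x)⁻¹ * T x := by
  rw [vol_eq, integral_withDensity_eq_integral_toReal_smul measurable_height_inv
    (.of_forall fun _ => ENNReal.ofReal_lt_top)]
  have h : ∀ x : E N, 0 ≤ (height x)⁻¹ := fun x => (inv_pos.2 (height_pos x)).le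
  simp only [smul_eq_mul, ENNReal.toReal_ofReal (h _)]

/-- The product measure `dσ ⊗ s^(N-1) ds` of polar coordinates. -/
abbrev polarMeasure (N : ℕ) : Measure (Metric.sphere (0 : E N) 1 × Set.Ioi (0 : ℝ)) :=
  (sphereMeasure N).prod (Measure.volumeIoiPow (N - 1))

theorem comp_homeomorphUnitSphereProd (F : E N → ℝ) (x : ({0}ᶜ : Set (E N))) :
    F ((homeomorphUnitSphereProd (E N) x).2.1 • (homeomorphUnitSphereProd (E N) x).1.1) = F x := by
  rw [← homeomorphUnitSphereProd_symm_apply_coe, Homeomorph.symm_apply_apply]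

theorem measurePreserving_polar :
    MeasurePreserving (homeomorphUnitSphereProd (E N)) (volume.comap Subtype.val)
      (polarMeasure N) := by
  have h := Measure.measurePreserving_homeomorphUnitSphereProd (volume : Measure (E N))
  rwa [finrank_euclideanSpace_fin] at h

theorem integrable_polar {F : E N → ℝ} (hF : Integrable F) :
    Integrable (fun z : Metric.sphere (0 : E N) 1 × Set.Ioi (0 : ℝ) => F (z.2.1 • z.1.1))
      (polarMeasure N) := by
  rw [← measurePreserving_polar.integrable_comp_emb
    (homeomorphUnitSphereProd (E N)).measurableEmbedding]
  have h : ((fun z : Metric.sphere (0 : E N) 1 × Set.Ioi (0 : ℝ) => F (z.2.1 • z.1.1)) ∘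
      homeomorphUnitSphereProd (E N)) = F ∘ Subtype.val := by
    funext x
    exact comp_homeomorphUnitSphereProd F x
  rw [h]
  exact (integrableOn_iff_comap_subtypeVal (measurableSet_singleton (0 : E N)).compl).1
    hF.integrableOn

section Polar

variable [Nontrivial (E N)]

theorem integral_polar (F : E N → ℝ) :
    ∫ x, F x = ∫ z, F (z.2.1 • z.1.1) ∂polarMeasure N := by
  rw [← measurePreserving_polar.integral_comp
    (homeomorphUnitSphereProd (E N)).measurableEmbedding]
  simp only [comp_homeomorphUnitSphereProd]
  rw [integral_subtype_comap (measurableSet_singleton _).compl F, restrict_compl_singleton]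

/-- Integration over spheres first: it preserves inequalities between spherical means. -/
theorem integral_mono_of_spheres {F G : E N → ℝ} (hF : Integrable F) (hG : Integrable G)
    (h : ∀ s : ℝ, 0 < s → ∫ σ : Metric.sphere (0 : E N) 1, F (s • (σ : E N)) ∂sphereMeasure N ≤
      ∫ σ : Metric.sphere (0 : E N) 1, G (s • (σ : E N)) ∂sphereMeasure N) :
    ∫ x, F x ≤ ∫ x, G x := by
  rw [integral_polar F, integral_polar G, integral_prod_symm _ (integrable_polar hF),
    integral_prod_symm _ (integrable_polar hG)]
  exact integral_mono (integrable_polar hF).integral_prod_right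
    (integrable_polar hG).integral_prod_right fun s => h s s.2

theorem volumeIoiPow_eq (n : ℕ) : Measure.volumeIoiPow n =
    (Measure.comap Subtype.val volume : Measure (Set.Ioi (0 : ℝ))).withDensity
      fun r => ENNReal.ofReal (r.1 ^ n) := rfl

/-- Integration over rays first: a function whose integrals along all rays vanish has integral
zero. -/
theorem integral_eq_zero_of_rays {F : E N → ℝ} (hF : Integrable F)
    (h : ∀ σ : E N, ‖σ‖ = 1 → IntegrableOn (fun s : ℝ => s ^ (N - 1) * F (s • σ)) (Set.Ioi 0) →
      ∫ s in Set.Ioi (0 : ℝ), s ^ (N - 1) * F (s • σ) = 0) :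
    ∫ x, F x = 0 := by
  have hm : Measurable fun r : Set.Ioi (0 : ℝ) => ENNReal.ofReal (r.1 ^ (N - 1)) := by fun_prop
  have htop : ∀ r : Set.Ioi (0 : ℝ), ENNReal.ofReal (r.1 ^ (N - 1)) < ⊤ :=
    fun _ => ENNReal.ofReal_lt_top
  have hto : ∀ r : Set.Ioi (0 : ℝ), (ENNReal.ofReal (r.1 ^ (N - 1))).toReal = r.1 ^ (N - 1) :=
    fun r => ENNReal.toReal_ofReal (pow_nonneg (Set.mem_Ioi.1 r.2).le _)
  rw [integral_polar F, integral_prod _ (integrable_polar hF)]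
  refine integral_eq_zero_of_ae ?_
  filter_upwards [(integrable_polar hF).prod_right_ae] with σ hσ
  rw [volumeIoiPow_eq, integrable_withDensity_iff_integrable_smul' hm (.of_forall htop)] at hσ
  simp only [hto, smul_eq_mul] at hσ
  rw [Pi.zero_apply, volumeIoiPow_eq, integral_withDensity_eq_integral_toReal_smul hm (.of_forall htop)]
  simp only [hto, smul_eq_mul]
  rw [integral_subtype_comap measurableSet_Ioi fun s : ℝ => s ^ (N - 1) * F (s • (σ : E N))]
  refine h σ (by simp) ?_
  exact (integrableOn_iff_comap_subtypeVal measurableSet_Ioi).2 hσ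

end Polar

/-- If `g f'` is nonnegative and `g'` is continuous, then `g f' = (g f)' - g' f` is integrable, although
`f'` need not be continuous: up to a continuous term it is a nonnegative derivative. -/
theorem integrableOn_mul_deriv {g f g' f' : ℝ → ℝ} {a b : ℝ}
    (hg : ∀ x ∈ Set.Icc a b, HasDerivAt g (g' x) x) (hf : ∀ x ∈ Set.Icc a b, HasDerivAt f (f' x) x)
    (hg' : ContinuousOn g' (Set.Icc a b)) (hpos : ∀ x ∈ Set.Icc a b, 0 ≤ g x * f' x) :
    IntegrableOn (fun x => g x * f' x) (Set.Icc a b) := by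
  have hfc : ContinuousOn f (Set.Icc a b) := fun x hx => (hf x hx).continuousAt.continuousWithinAt
  have hgc : ContinuousOn g (Set.Icc a b) := fun x hx => (hg x hx).continuousAt.continuousWithinAt
  obtain ⟨M, hM⟩ := isCompact_Icc.exists_bound_of_continuousOn (hg'.mul hfc)
  have h1 : IntegrableOn (fun x => (g' x * f x + g x * f' x) + M) (Set.Ioc a b) := by
    refine intervalIntegral.integrableOn_deriv_of_nonneg (g := fun x => g x * f x + M * x)
      ((hgc.mul hfc).add (by fun_prop)) (fun x hx => ?_) fun x hx => ?_
    · have hx' := Set.Ioo_subset_Icc_self hx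
      have hM := (hasDerivAt_id x).const_mul M
      rw [mul_one] at hM
      exact ((hg x hx').mul (hf x hx')).add hM
    · have hx' := Set.Ioo_subset_Icc_self hx
      have h2 := neg_le_of_abs_le (hM x hx')
      have h3 := hpos x hx'
      simp only [Pi.mul_apply] at h2
      linarith
  rw [← integrableOn_Icc_iff_integrableOn_Ioc] at h1
  have h2 : IntegrableOn (fun x => g' x * f x + M) (Set.Icc a b) :=
    ((hg'.mul hfc).add continuousOn_const).integrableOn_Icc
  refine (h1.sub h2).congr_fun (fun x _ => ?_) measurableSet_Icc
  simp only [Pi.sub_apply]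
  ring

/-- Radial functions that are integrable on a compact subinterval of `(0, ∞)` are integrable on the
corresponding annulus. -/
theorem integrableOn_annulus [Nontrivial (E N)] {h : ℝ → ℝ} {a b : ℝ}
    (hh : IntegrableOn h (Set.Icc a b)) :
    IntegrableOn (fun x : E N => h ‖x‖) {x | ‖x‖ ∈ Set.Icc a b} := by
  have h1 : Integrable (fun x : E N => (Set.Icc a b).indicator h ‖x‖) := by
    rw [integrable_fun_norm_addHaar]
    have h2 : IntegrableOn (fun y => h y * y ^ (Module.finrank ℝ (E N) - 1)) (Set.Icc a b) :=
      hh.mul_continuousOn (by fun_prop) isCompact_Icc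
    refine ((integrable_indicator_iff measurableSet_Icc).2 h2).integrableOn.congr_fun
      (fun y _ => ?_) measurableSet_Ioi
    by_cases hy : y ∈ Set.Icc a b <;> simp [hy, mul_comm]
  refine h1.integrableOn.congr_fun (fun x hx => ?_) ?_
  · exact Set.indicator_of_mem (show ‖x‖ ∈ Set.Icc a b from hx) h
  · exact measurableSet_Icc.preimage measurable_norm

/-! ### The terms of the inequality -/

/-- The density `V(r) |∇u|²`, with `r` the distance to `p`. -/
def gradTerm (p : E N) (V : ℝ → ℝ) (u : E N → ℝ) (x : E N) : ℝ :=
  V (hdist p x) * gradSq u x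

/-- The density `W(r) u²`. -/
def potentialTerm (p : E N) (W : ℝ → ℝ) (u : E N → ℝ) (x : E N) : ℝ :=
  W (hdist p x) * u x ^ 2

/-- The density `V(r) u² / sinh² r`. -/
def hardyTerm (p : E N) (V : ℝ → ℝ) (u : E N → ℝ) (x : E N) : ℝ :=
  V (hdist p x) * u x ^ 2 / Real.sinh (hdist p x) ^ 2

/-- The density `V(r) f(r)² |∂_r (u / f(r))|²`. -/
def remainderTerm (p : E N) (V f : ℝ → ℝ) (u : E N → ℝ) (x : E N) : ℝ :=
  V (hdist p x) * f (hdist p x) ^ 2 *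
    (radialDeriv p (fun z => u z / f (hdist p z)) x) ^ 2

/-- The density `V(r) (f'(r) / f(r)) (coth r - 1 / r) u²`. -/
def volumeTerm (p : E N) (V f : ℝ → ℝ) (u : E N → ℝ) (x : E N) : ℝ :=
  V (hdist p x) * (deriv f (hdist p x) / f (hdist p x)) *
    (Real.cosh (hdist p x) / Real.sinh (hdist p x) - 1 / hdist p x) * u x ^ 2

/-- The radial part `V(r) (∂_r u)²` of `V(r) |∇u|²`. -/
def radialTerm (V : ℝ → ℝ) (u : E N → ℝ) (x : E N) : ℝ :=
  V (hdist 0 x) * radialDeriv 0 u x ^ 2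

/-- The angular part `V(r) |∇_S u|² / sinh² r` of `V(r) |∇u|²`. -/
def angularTerm (V : ℝ → ℝ) (u : E N → ℝ) (x : E N) : ℝ :=
  V (hdist 0 x) * (sphGrad u u x / ‖x‖ ^ 2)

theorem dir_zero (x : E N) : dir 0 x = ‖x‖⁻¹ • x := by
  simpa [boost_zero] using dir_boost 0 x

/-- Polar coordinates represent every point; at the pole, where `dir` is zero, this holds because
`sinh 0 = 0`. -/
theorem polar_hdist_dir (x : E N) : polar 0 (hdist 0 x) (dir 0 x) = x := by
  rw [polar_zero, hdist_zero, dir_zero, Real.sinh_arsinh]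
  rcases eq_or_ne x 0 with rfl | hx
  · simp
  · rw [smul_smul, mul_inv_cancel₀ (norm_ne_zero_iff.2 hx), one_smul]

theorem continuous_polar_zero (σ : E N) : Continuous fun t => polar 0 t σ := by
  simp only [polar_zero]
  exact Real.continuous_sinh.smul continuous_const

theorem radialDeriv_eq_zero {w : E N → ℝ} {x : E N} (hw : w =ᶠ[nhds x] 0) :
    radialDeriv 0 w x = 0 := by
  have h : Filter.Tendsto (fun t => polar 0 t (dir 0 x)) (nhds (hdist 0 x)) (nhds x) := by
    have := (continuous_polar_zero (dir 0 x)).tendsto (hdist 0 x)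
    rwa [polar_hdist_dir] at this
  have h2 : (fun t => w (polar 0 t (dir 0 x))) =ᶠ[nhds (hdist 0 x)] fun _ => 0 :=
    h.eventually hw
  rw [radialDeriv, h2.deriv_eq, deriv_const]

theorem hasDerivAt_comp_polar {u : E N → ℝ} (hu : Differentiable ℝ u) (x : E N) :
    HasDerivAt (fun t => u (polar 0 t (dir 0 x))) (height x * fderiv ℝ u x (‖x‖⁻¹ • x))
      (hdist 0 x) := by
  have h1 : HasDerivAt (fun t => polar 0 t (dir 0 x)) (height x • (‖x‖⁻¹ • x)) (hdist 0 x) := by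
    simp only [polar_zero]
    have h2 : Real.cosh (hdist 0 x) = height x := by
      rw [hdist_zero, Real.cosh_arsinh]
      rfl
    rw [← h2, ← dir_zero]
    exact (Real.hasDerivAt_sinh _).smul_const _
  have h3 := (hu (polar 0 (hdist 0 x) (dir 0 x))).hasFDerivAt.comp_hasDerivAt _ h1
  rw [polar_hdist_dir, map_smul, smul_eq_mul] at h3
  exact h3

theorem radialDeriv_zero {u : E N → ℝ} (hu : Differentiable ℝ u) (x : E N) :
    radialDeriv 0 u x = height x * fderiv ℝ u x (‖x‖⁻¹ • x) :=
  (hasDerivAt_comp_polar hu x).deriv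

theorem hdist_zero_pos {x : E N} (hx : x ≠ 0) : 0 < hdist 0 x := by
  rw [hdist_zero]
  exact Real.arsinh_pos_iff.2 (norm_pos_iff.2 hx)

theorem radialDeriv_div {u : E N → ℝ} (hu : Differentiable ℝ u) {f : ℝ → ℝ} {x : E N} (hx : x ≠ 0)
    (hf : DifferentiableAt ℝ f (hdist 0 x)) (hf0 : f (hdist 0 x) ≠ 0) :
    radialDeriv 0 (fun z => u z / f (hdist 0 z)) x =
      (radialDeriv 0 u x * f (hdist 0 x) - u x * deriv f (hdist 0 x)) / f (hdist 0 x) ^ 2 := by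
  have h1 := (hasDerivAt_comp_polar hu x).div hf.hasDerivAt hf0
  rw [← radialDeriv_zero hu, polar_hdist_dir] at h1
  have h2 : (fun t => u (polar 0 t (dir 0 x)) / f (hdist 0 (polar 0 t (dir 0 x)))) =ᶠ[nhds (hdist 0 x)]
      (fun t => u (polar 0 t (dir 0 x))) / f := by
    filter_upwards [lt_mem_nhds (hdist_zero_pos hx)] with t ht
    have h3 : ‖dir 0 x‖ = 1 := by
      rw [dir_zero, norm_smul, norm_inv, norm_norm, inv_mul_cancel₀ (norm_ne_zero_iff.2 hx)]
    have h4 : hdist 0 (polar 0 t (dir 0 x)) = t := by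
      rw [hdist_zero, polar_zero, norm_smul, h3, mul_one, Real.norm_eq_abs,
        abs_of_pos (Real.sinh_pos_iff.2 ht), Real.arsinh_sinh]
    rw [h4, Pi.div_apply]
  exact (h1.congr_of_eventuallyEq h2).deriv

theorem sphGrad_self (u : E N → ℝ) (x : E N) :
    sphGrad u u x = ‖x‖ ^ 2 * ∑ i, fderiv ℝ u x (EuclideanSpace.single i 1) ^ 2 -
      fderiv ℝ u x x ^ 2 := by
  set d : Fin N → ℝ := fun i => fderiv ℝ u x (EuclideanSpace.single i 1)
  have h1 : ∀ i j, rot i j u x * rot i j u x =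
      x i ^ 2 * d j ^ 2 + x j ^ 2 * d i ^ 2 - 2 * ((x i * d i) * (x j * d j)) := by
    intro i j
    simp only [rot, map_sub, map_smul, smul_eq_mul, d]
    ring
  rw [EuclideanSpace.real_norm_sq_eq, ← sum_coord_mul_fderiv u x x]
  simp only [sphGrad, h1, Finset.sum_sub_distrib, Finset.sum_add_distrib, ← Finset.mul_sum,
    ← Finset.sum_mul]
  ring

theorem gradSq_eq_radial_add_angular {u : E N → ℝ} (hu : Differentiable ℝ u) {x : E N}
    (hx : x ≠ 0) : gradSq u x = radialDeriv 0 u x ^ 2 + sphGrad u u x / ‖x‖ ^ 2 := by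
  have h := norm_ne_zero_iff.2 hx
  rw [gradSq_eq, radialDeriv_zero hu, sphGrad_self, mul_pow, height_sq, map_smul, smul_eq_mul]
  field_simp
  ring

section ZeroPole

variable {R : EReal} {V W f : ℝ → ℝ} {u : E N → ℝ}

theorem continuousOn_of_pow_mul {n : ℕ} {V : ℝ → ℝ}
    (h : ContDiffOn ℝ 1 (fun r => r ^ n * V r) (interval R)) : ContinuousOn V (interval R) := by
  have h1 : ContinuousOn (fun r => (r ^ n)⁻¹ * (r ^ n * V r)) (interval R) :=
    (ContinuousOn.inv₀ (by fun_prop) fun r hr => pow_ne_zero _ hr.1.ne').mul h.continuousOn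
  refine h1.congr fun r hr => ?_
  have := pow_ne_zero n hr.1.ne'
  field_simp

theorem mem_interval_of_mem_tsupport (hu : IsTestFunction (ball 0 R \ {0}) u) {x : E N}
    (hx : x ∈ tsupport u) : x ≠ 0 ∧ hdist 0 x ∈ interval R := by
  have h := hu.2.2 hx
  exact ⟨h.2, hdist_zero_pos h.2, h.1⟩

theorem fderiv_eq_zero_of_notMem {x : E N} (hx : x ∉ tsupport u) : fderiv ℝ u x = 0 := by
  have h : u =ᶠ[nhds x] fun _ => 0 := notMem_tsupport_iff_eventuallyEq.1 hx
  rw [h.fderiv_eq]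
  simp

theorem gradTerm_eq_zero {x : E N} (hx : x ∉ tsupport u) : gradTerm 0 V u x = 0 := by
  simp [gradTerm, gradSq_eq, fderiv_eq_zero_of_notMem hx]

theorem potentialTerm_eq_zero {x : E N} (hx : x ∉ tsupport u) : potentialTerm 0 W u x = 0 := by
  simp [potentialTerm, image_eq_zero_of_notMem_tsupport hx]

theorem hardyTerm_eq_zero {x : E N} (hx : x ∉ tsupport u) : hardyTerm 0 V u x = 0 := by
  simp [hardyTerm, image_eq_zero_of_notMem_tsupport hx]

theorem volumeTerm_eq_zero {x : E N} (hx : x ∉ tsupport u) : volumeTerm 0 V f u x = 0 := by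
  simp [volumeTerm, image_eq_zero_of_notMem_tsupport hx]

theorem remainderTerm_eq_zero {x : E N} (hx : x ∉ tsupport u) : remainderTerm 0 V f u x = 0 := by
  have h : (fun z => u z / f (hdist 0 z)) =ᶠ[nhds x] 0 := by
    filter_upwards [notMem_tsupport_iff_eventuallyEq.1 hx] with z hz
    simp [hz]
  simp [remainderTerm, radialDeriv_eq_zero h]

theorem radialTerm_eq_zero {x : E N} (hx : x ∉ tsupport u) : radialTerm V u x = 0 := by
  simp [radialTerm, radialDeriv_eq_zero (notMem_tsupport_iff_eventuallyEq.1 hx)]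

theorem angularTerm_eq_zero {x : E N} (hx : x ∉ tsupport u) : angularTerm V u x = 0 := by
  simp [angularTerm, sphGrad, rot, fderiv_eq_zero_of_notMem hx]

theorem integrable_vol_of_integrableOn {T : E N → ℝ} {K : Set (E N)} (hK : IsCompact K)
    (hT : IntegrableOn T K) (h0 : ∀ x ∉ K, T x = 0) : Integrable T (vol N) := by
  rw [integrable_vol_iff, ← integrableOn_iff_integrable_of_support_subset (s := K)]
  · exact hT.continuousOn_mul
      (contDiff_height.continuous.inv₀ fun x => (height_pos x).ne').continuousOn hK
  · intro x hx
    by_contra h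
    simp [h0 x h] at hx

theorem continuousOn_comp_hdist {h : ℝ → ℝ} (hu : IsTestFunction (ball 0 R \ {0}) u)
    (hh : ContinuousOn h (interval R)) : ContinuousOn (fun x => h (hdist 0 x)) (tsupport u) := by
  refine hh.comp ?_ fun x hx => (mem_interval_of_mem_tsupport hu hx).2
  rw [show hdist (0 : E N) = fun x => Real.arsinh ‖x‖ from funext hdist_zero]
  exact (Real.continuous_arsinh.comp continuous_norm).continuousOn

/-- The support lies in a closed annulus inside the punctured ball; the annulus is empty when `u = 0`. -/
theorem exists_annulus (hu : IsTestFunction (ball 0 R \ {0}) u) :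
    ∃ a b : ℝ, 0 < a ∧ (∀ s ∈ Set.Icc a b, Real.arsinh s ∈ interval R) ∧
      ∀ x ∈ tsupport u, ‖x‖ ∈ Set.Icc a b := by
  have hK : IsCompact (tsupport u) := hu.2.1
  rcases (tsupport u).eq_empty_or_nonempty with h | h
  · exact ⟨1, 0, one_pos, fun s hs => absurd (hs.1.trans hs.2) (by norm_num), by simp [h]⟩
  obtain ⟨y, hy, hy'⟩ := hK.exists_isMinOn h continuous_norm.continuousOn
  obtain ⟨z, hz, hz'⟩ := hK.exists_isMaxOn h continuous_norm.continuousOn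
  have hy0 := norm_pos_iff.2 (mem_interval_of_mem_tsupport hu hy).1
  refine ⟨‖y‖, ‖z‖, hy0, fun s hs => ⟨Real.arsinh_pos_iff.2 (hy0.trans_le hs.1), ?_⟩,
    fun x hx => ⟨hy' hx, hz' hx⟩⟩
  have h1 := (mem_interval_of_mem_tsupport hu hz).2.2
  rw [hdist_zero] at h1
  exact (EReal.coe_le_coe_iff.2 (Real.arsinh_le_arsinh.2 hs.2)).trans_lt h1

end ZeroPole

/-! ### Integrability, and the derivative along rays -/

section ZeroPole

variable {R : EReal} {V W f : ℝ → ℝ} {u : E N → ℝ}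

theorem continuous_sqrt_one_add_sq_inv : Continuous fun s : ℝ => (√(1 + s ^ 2))⁻¹ :=
  Continuous.inv₀ (by fun_prop) fun s => (Real.sqrt_pos.2 (by positivity)).ne'

theorem continuousOn_hdist_tsupport (hu : IsTestFunction (ball 0 R \ {0}) u) :
    ContinuousOn (hdist 0) (tsupport u) :=
  continuousOn_comp_hdist hu continuousOn_id

theorem continuousOn_radialDeriv (hu : IsTestFunction (ball 0 R \ {0}) u) :
    ContinuousOn (radialDeriv 0 u) (tsupport u) := by
  have hd : Differentiable ℝ u := hu.1.differentiable (by simp)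
  rw [show radialDeriv 0 u = fun x => height x * fderiv ℝ u x (‖x‖⁻¹ • x) from
    funext (radialDeriv_zero hd)]
  have h1 : ContinuousOn (fun x : E N => ‖x‖⁻¹) (tsupport u) :=
    continuous_norm.continuousOn.inv₀ fun x hx =>
      norm_ne_zero_iff.2 (mem_interval_of_mem_tsupport hu hx).1
  exact contDiff_height.continuous.continuousOn.mul
    ((hu.1.continuous_fderiv (by simp)).continuousOn.clm_apply (h1.smul continuousOn_id))

theorem continuousOn_flux (hf : IsPositiveSolution (fun r => r ^ (N - 1) * V r)
    (fun r => r ^ (N - 1) * W r) R f) : ContinuousOn (fun r => V r * deriv f r) (interval R) := by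
  have h1 : ContinuousOn (fun r => (r ^ (N - 1))⁻¹ * (r ^ (N - 1) * V r * deriv f r)) (interval R) :=
    (ContinuousOn.inv₀ (by fun_prop) fun r hr => pow_ne_zero _ hr.1.ne').mul
      fun r hr => (hf r hr).2.2.continuousAt.continuousWithinAt
  refine h1.congr fun r hr => ?_
  have := pow_ne_zero (N - 1) hr.1.ne'
  field_simp

theorem continuousOn_solution {A B : ℝ → ℝ} (hf : IsPositiveSolution A B R f) :
    ContinuousOn f (interval R) :=
  fun r hr => (hf r hr).2.1.continuousAt.continuousWithinAt

theorem integrable_gradTerm (hu : IsTestFunction (ball 0 R \ {0}) u)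
    (hV : ContinuousOn V (interval R)) : Integrable (gradTerm 0 V u) (vol N) := by
  refine integrable_vol_of_integrableOn hu.2.1 (ContinuousOn.integrableOn_compact hu.2.1 ?_)
    fun x hx => gradTerm_eq_zero hx
  have h1 : Continuous (gradSq u) := by
    have := hu.1.continuous_fderiv (by simp)
    rw [show gradSq u = _ from funext (gradSq_eq u)]
    fun_prop
  exact (continuousOn_comp_hdist hu hV).mul h1.continuousOn

theorem integrable_potentialTerm (hu : IsTestFunction (ball 0 R \ {0}) u)
    (hW : ContinuousOn W (interval R)) : Integrable (potentialTerm 0 W u) (vol N) := by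
  refine integrable_vol_of_integrableOn hu.2.1 (ContinuousOn.integrableOn_compact hu.2.1 ?_)
    fun x hx => potentialTerm_eq_zero hx
  exact (continuousOn_comp_hdist hu hW).mul (hu.1.continuous.pow 2).continuousOn

theorem integrable_hardyTerm (hu : IsTestFunction (ball 0 R \ {0}) u)
    (hV : ContinuousOn V (interval R)) : Integrable (hardyTerm 0 V u) (vol N) := by
  refine integrable_vol_of_integrableOn hu.2.1 (ContinuousOn.integrableOn_compact hu.2.1 ?_)
    fun x hx => hardyTerm_eq_zero hx
  have h1 : ContinuousOn (fun x => Real.sinh (hdist 0 x) ^ 2) (tsupport u) :=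
    (Real.continuous_sinh.pow 2).comp_continuousOn (continuousOn_hdist_tsupport hu)
  exact ((continuousOn_comp_hdist hu hV).mul (hu.1.continuous.pow 2).continuousOn).div h1
    fun x hx => pow_ne_zero _ (Real.sinh_pos_iff.2 (mem_interval_of_mem_tsupport hu hx).2.1).ne'

theorem integrable_volumeTerm (hu : IsTestFunction (ball 0 R \ {0}) u)
    (hf : IsPositiveSolution (fun r => r ^ (N - 1) * V r) (fun r => r ^ (N - 1) * W r) R f) :
    Integrable (volumeTerm 0 V f u) (vol N) := by
  refine integrable_vol_of_integrableOn hu.2.1 (ContinuousOn.integrableOn_compact hu.2.1 ?_)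
    fun x hx => volumeTerm_eq_zero hx
  have h1 : ContinuousOn (fun r => V r * (deriv f r / f r) *
      (Real.cosh r / Real.sinh r - 1 / r)) (interval R) := by
    have h2 : ContinuousOn (fun r => V r * deriv f r / f r) (interval R) :=
      (continuousOn_flux hf).div (continuousOn_solution hf) fun r hr => (hf r hr).1.ne'
    simp only [mul_div_assoc] at h2
    exact h2.mul ((Real.continuous_cosh.continuousOn.div Real.continuous_sinh.continuousOn
      fun r hr => (Real.sinh_pos_iff.2 hr.1).ne').sub
      (continuousOn_const.div continuousOn_id fun r hr => hr.1.ne'))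
  exact (continuousOn_comp_hdist hu h1).mul (hu.1.continuous.pow 2).continuousOn

theorem integrable_radialTerm (hu : IsTestFunction (ball 0 R \ {0}) u)
    (hV : ContinuousOn V (interval R)) : Integrable (radialTerm V u) (vol N) :=
  integrable_vol_of_integrableOn hu.2.1 (ContinuousOn.integrableOn_compact hu.2.1
    ((continuousOn_comp_hdist hu hV).mul ((continuousOn_radialDeriv hu).pow 2)))
    fun _ hx => radialTerm_eq_zero hx

theorem integrable_angularTerm (hu : IsTestFunction (ball 0 R \ {0}) u)
    (hV : ContinuousOn V (interval R)) : Integrable (angularTerm V u) (vol N) := by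
  refine integrable_vol_of_integrableOn hu.2.1 (ContinuousOn.integrableOn_compact hu.2.1 ?_)
    fun x hx => angularTerm_eq_zero hx
  have hc : ContDiff ℝ 1 u := hu.1.of_le (by simp)
  exact (continuousOn_comp_hdist hu hV).mul ((continuous_sphGrad hc hc).continuousOn.div
    (continuous_norm.pow 2).continuousOn fun x hx =>
      pow_ne_zero _ (norm_ne_zero_iff.2 (mem_interval_of_mem_tsupport hu hx).1))

/-- `V f'²` is integrable on annuli, even though `f'` may be unbounded near the zeros of `V`. -/
theorem integrableOn_mul_deriv_sq [Nontrivial (E N)] (hV : ∀ r ∈ interval R, 0 ≤ V r)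
    (hW : ContinuousOn W (interval R))
    (hf : IsPositiveSolution (fun r => r ^ (N - 1) * V r) (fun r => r ^ (N - 1) * W r) R f)
    (hu : IsTestFunction (ball 0 R \ {0}) u) :
    IntegrableOn (fun x => V (hdist 0 x) * deriv f (hdist 0 x) ^ 2) (tsupport u) := by
  obtain ⟨a, b, -, hI, hK⟩ := exists_annulus hu
  have har : ContinuousOn Real.arsinh (Set.Icc a b) := Real.continuous_arsinh.continuousOn
  have h1 := integrableOn_mul_deriv (a := a) (b := b)
    (g := fun s => Real.arsinh s ^ (N - 1) * V (Real.arsinh s) * deriv f (Real.arsinh s))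
    (f := fun s => f (Real.arsinh s))
    (g' := fun s => -(Real.arsinh s ^ (N - 1) * W (Real.arsinh s) * f (Real.arsinh s)) *
      (√(1 + s ^ 2))⁻¹)
    (f' := fun s => deriv f (Real.arsinh s) * (√(1 + s ^ 2))⁻¹)
    (fun s hs => (hf _ (hI s hs)).2.2.comp s (Real.hasDerivAt_arsinh s))
    (fun s hs => (hf _ (hI s hs)).2.1.hasDerivAt.comp s (Real.hasDerivAt_arsinh s))
    ((((har.pow _).mul (hW.comp har hI)).mul ((continuousOn_solution hf).comp har hI)).neg.mul
      continuous_sqrt_one_add_sq_inv.continuousOn)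
    (fun s hs => by
      have h2 := hV _ (hI s hs)
      have h3 := (hI s hs).1
      have h4 : 0 ≤ Real.arsinh s ^ (N - 1) * V (Real.arsinh s) *
        deriv f (Real.arsinh s) ^ 2 * (√(1 + s ^ 2))⁻¹ := by positivity
      calc (0 : ℝ) ≤ _ := h4
        _ = _ := by ring)
  have h2 : IntegrableOn (fun s => V (Real.arsinh s) * deriv f (Real.arsinh s) ^ 2)
      (Set.Icc a b) := by
    refine (h1.mul_continuousOn (g' := fun s => √(1 + s ^ 2) * (Real.arsinh s ^ (N - 1))⁻¹)
      ((by fun_prop : Continuous fun s : ℝ => √(1 + s ^ 2)).continuousOn.mul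
        ((har.pow _).inv₀ fun s hs => pow_ne_zero _ (hI s hs).1.ne')) isCompact_Icc).congr_fun
      (fun s hs => ?_) measurableSet_Icc
    have h3 := pow_ne_zero (N - 1) (hI s hs).1.ne'
    have h4 : √(1 + s ^ 2) ≠ 0 := (Real.sqrt_pos.2 (by positivity)).ne'
    simp only
    field_simp
  have h3 := (integrableOn_annulus (N := N) h2).mono_set (s := tsupport u) hK
  simpa only [hdist_zero] using h3

theorem remainderTerm_eq (hu : IsTestFunction (ball 0 R \ {0}) u)
    {A B : ℝ → ℝ} (hf : IsPositiveSolution A B R f) {x : E N} (hx : x ≠ 0)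
    (hr : hdist 0 x ∈ interval R) :
    remainderTerm 0 V f u x = radialTerm V u x -
      2 * (V (hdist 0 x) * deriv f (hdist 0 x)) * (u x * radialDeriv 0 u x / f (hdist 0 x)) +
      V (hdist 0 x) * deriv f (hdist 0 x) ^ 2 * (u x ^ 2 / f (hdist 0 x) ^ 2) := by
  have h := (hf _ hr).1.ne'
  rw [remainderTerm, radialTerm, radialDeriv_div (hu.1.differentiable (by simp)) hx (hf _ hr).2.1 h]
  field_simp
  ring

theorem integrable_remainderTerm [Nontrivial (E N)] (hV : ∀ r ∈ interval R, 0 ≤ V r)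
    (hVc : ContinuousOn V (interval R)) (hW : ContinuousOn W (interval R))
    (hf : IsPositiveSolution (fun r => r ^ (N - 1) * V r) (fun r => r ^ (N - 1) * W r) R f)
    (hu : IsTestFunction (ball 0 R \ {0}) u) :
    Integrable (remainderTerm 0 V f u) (vol N) := by
  refine integrable_vol_of_integrableOn hu.2.1 ?_ fun x hx => remainderTerm_eq_zero hx
  have hK : IsCompact (tsupport u) := hu.2.1
  have hfc := continuousOn_comp_hdist hu (continuousOn_solution hf)
  have hf0 : ∀ x ∈ tsupport u, f (hdist 0 x) ≠ 0 := fun x hx =>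
    (hf _ (mem_interval_of_mem_tsupport hu hx).2).1.ne'
  have huc := hu.1.continuous.continuousOn (s := tsupport u)
  have h1 : IntegrableOn (radialTerm V u) (tsupport u) := ContinuousOn.integrableOn_compact hK
    ((continuousOn_comp_hdist hu hVc).mul ((continuousOn_radialDeriv hu).pow 2))
  have h2 : IntegrableOn (fun x => 2 * (V (hdist 0 x) * deriv f (hdist 0 x)) *
      (u x * radialDeriv 0 u x / f (hdist 0 x))) (tsupport u) :=
    ContinuousOn.integrableOn_compact hK
      ((continuousOn_const.mul (continuousOn_comp_hdist hu (continuousOn_flux hf))).mul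
        ((huc.mul (continuousOn_radialDeriv hu)).div hfc hf0))
  have h3 := (integrableOn_mul_deriv_sq hV hW hf hu).mul_continuousOn
    (g' := fun x => u x ^ 2 / f (hdist 0 x) ^ 2)
    ((huc.pow 2).div (hfc.pow 2) fun x hx => pow_ne_zero _ (hf0 x hx)) hK
  refine ((h1.sub h2).add h3).congr_fun (fun x hx => ?_) (isClosed_tsupport u).measurableSet
  have hx' := mem_interval_of_mem_tsupport hu hx
  rw [remainderTerm_eq hu hf hx'.1 hx'.2]
  rfl

/-- Along each ray the radial terms add up to the derivative of
`V (f' / f) u² sinh^(N-1) r`, written in the variable `s = sinh r`. -/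
theorem hasDerivAt_ray (hN : 2 ≤ N)
    (hf : IsPositiveSolution (fun r => r ^ (N - 1) * V r) (fun r => r ^ (N - 1) * W r) R f)
    (hu : IsTestFunction (ball 0 R \ {0}) u) {σ : E N} (hσ : ‖σ‖ = 1) {s : ℝ} (hs : 0 < s) :
    HasDerivAt (fun t : ℝ => Real.arsinh t ^ (N - 1) * V (Real.arsinh t) * deriv f (Real.arsinh t) /
        f (Real.arsinh t) * (t / Real.arsinh t) ^ (N - 1) * u (t • σ) ^ 2)
      (s ^ (N - 1) * ((height (s • σ))⁻¹ * (radialTerm V u (s • σ) - potentialTerm 0 W u (s • σ) -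
        remainderTerm 0 V f u (s • σ) + ((N : ℝ) - 1) * volumeTerm 0 V f u (s • σ)))) s := by
  by_cases hx : s • σ ∈ tsupport u
  · have hud : Differentiable ℝ u := hu.1.differentiable (by simp)
    obtain ⟨hx0, hr⟩ := mem_interval_of_mem_tsupport hu hx
    have hnorm : ‖s • σ‖ = s := by rw [norm_smul, hσ, mul_one, Real.norm_of_nonneg hs.le]
    have hh : height (s • σ) = √(1 + s ^ 2) := by rw [height, hnorm]
    have hrad : radialDeriv 0 u (s • σ) = √(1 + s ^ 2) * fderiv ℝ u (s • σ) σ := by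
      rw [radialDeriv_zero hud, hh, hnorm, smul_smul, inv_mul_cancel₀ hs.ne', one_smul]
    have hvol : volumeTerm 0 V f u (s • σ) = V (Real.arsinh s) *
        (deriv f (Real.arsinh s) / f (Real.arsinh s)) *
        (√(1 + s ^ 2) / s - 1 / Real.arsinh s) * u (s • σ) ^ 2 := by
      simp only [volumeTerm, hdist_zero, hnorm, Real.cosh_arsinh, Real.sinh_arsinh]
    rw [remainderTerm_eq hu hf hx0 hr, hvol, potentialTerm, hrad, hh]
    rw [hdist_zero, hnorm] at hr ⊢
    have hfr := hf _ hr
    have hρ := Real.hasDerivAt_arsinh s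
    have d1 := hfr.2.2.comp s hρ
    have d2 := hfr.2.1.hasDerivAt.comp s hρ
    have d3 := ((hasDerivAt_id s).div hρ hr.1.ne').pow (N - 1)
    have d4 : HasDerivAt (fun t : ℝ => u (t • σ)) (fderiv ℝ u (s • σ) σ) s := by
      have h := (hasDerivAt_id s).smul_const σ
      rw [one_smul] at h
      exact (hud (s • σ)).hasFDerivAt.comp_hasDerivAt s h
    have d5 := ((d1.div d2 hfr.1.ne').mul d3).mul (d4.pow 2)
    refine d5.congr_deriv ?_
    have hc : √(1 + s ^ 2) ≠ 0 := (Real.sqrt_pos.2 (by positivity)).ne'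
    have hρ0 := hr.1.ne'
    have hf0 := hfr.1.ne'
    have hs0 := hs.ne'
    simp only [Function.comp_apply, Pi.div_apply, Pi.pow_apply, Pi.mul_apply, id]
    generalize √(1 + s ^ 2) = c at *
    generalize Real.arsinh s = ρ at *
    generalize f ρ = F at *
    generalize deriv f ρ = F' at *
    generalize V ρ = v at *
    generalize W ρ = w at *
    generalize fderiv ℝ u (s • σ) σ = D at *
    generalize u (s • σ) = U at *
    obtain ⟨m, rfl⟩ : ∃ m, N = m + 2 := ⟨N - 2, by omega⟩
    simp only [show m + 2 - 1 = m + 1 by omega, show m + 1 - 1 = m by omega]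
    push_cast
    simp only [div_pow]
    field_simp
    ring
  · have h1 : (fun t : ℝ => u (t • σ)) =ᶠ[nhds s] fun _ => 0 :=
      (Continuous.tendsto (by fun_prop : Continuous fun t : ℝ => t • σ) s).eventually
        (notMem_tsupport_iff_eventuallyEq.1 hx)
    have h2 : (fun t : ℝ => Real.arsinh t ^ (N - 1) * V (Real.arsinh t) *
        deriv f (Real.arsinh t) / f (Real.arsinh t) * (t / Real.arsinh t) ^ (N - 1) *
        u (t • σ) ^ 2) =ᶠ[nhds s] fun _ => 0 := by
      filter_upwards [h1] with t ht
      simp [ht]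
    rw [radialTerm_eq_zero hx, potentialTerm_eq_zero hx, remainderTerm_eq_zero hx,
      volumeTerm_eq_zero hx]
    simpa using (hasDerivAt_const s (0 : ℝ)).congr_of_eventuallyEq h2

end ZeroPole

/-! ### Integration and transport of the pole -/

section ZeroPole

variable {R : EReal} {V W f : ℝ → ℝ} {u : E N → ℝ}

theorem nontrivial_E (hN : 2 ≤ N) : Nontrivial (E N) :=
  Module.nontrivial_of_finrank_pos (R := ℝ) (by rw [finrank_euclideanSpace_fin]; omega)

/-- The radial identity: integration along rays of the derivative of a compactly supported
function. -/
theorem integral_radialTerm (hN : 2 ≤ N) (hV : ∀ r ∈ interval R, 0 ≤ V r)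
    (hVc : ContinuousOn V (interval R)) (hW : ContinuousOn W (interval R))
    (hf : IsPositiveSolution (fun r => r ^ (N - 1) * V r) (fun r => r ^ (N - 1) * W r) R f)
    (hu : IsTestFunction (ball 0 R \ {0}) u) :
    ∫ x, radialTerm V u x ∂vol N = (∫ x, potentialTerm 0 W u x ∂vol N) +
      (∫ x, remainderTerm 0 V f u x ∂vol N) -
        ((N : ℝ) - 1) * ∫ x, volumeTerm 0 V f u x ∂vol N := by
  have := nontrivial_E hN
  have i1 := integrable_radialTerm hu hVc
  have i2 := integrable_potentialTerm hu hW
  have i3 := integrable_remainderTerm hV hVc hW hf hu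
  have i4 := (integrable_volumeTerm hu hf).const_mul ((N : ℝ) - 1)
  have hzero : ∫ x, (radialTerm V u x - potentialTerm 0 W u x - remainderTerm 0 V f u x +
      ((N : ℝ) - 1) * volumeTerm 0 V f u x) ∂vol N = 0 := by
    rw [integral_vol]
    refine integral_eq_zero_of_rays (integrable_vol_iff.1 (((i1.sub i2).sub i3).add i4))
      fun σ hσ hint => ?_
    obtain ⟨a, b, ha, -, hab⟩ := exists_annulus hu
    -- `u` vanishes near the origin and near infinity along the ray
    have hout : ∀ t : ℝ, 0 ≤ t → t ∉ Set.Icc a b → u (t • σ) = 0 := by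
      intro t ht htab
      refine image_eq_zero_of_notMem_tsupport fun h => htab ?_
      have := hab _ h
      rwa [norm_smul, hσ, mul_one, Real.norm_of_nonneg ht] at this
    rw [integral_Ioi_of_hasDerivAt_of_tendsto (m := 0) ?_
      (fun s hs => hasDerivAt_ray hN hf hu hσ hs) hint ?_]
    · rw [hout 0 le_rfl fun h => absurd h.1 (not_le.2 ha)]
      simp
    · have h : (fun t : ℝ => Real.arsinh t ^ (N - 1) * V (Real.arsinh t) *
          deriv f (Real.arsinh t) / f (Real.arsinh t) * (t / Real.arsinh t) ^ (N - 1) *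
          u (t • σ) ^ 2) =ᶠ[nhdsWithin 0 (Set.Ici 0)] fun _ => 0 := by
        filter_upwards [self_mem_nhdsWithin, mem_nhdsWithin_of_mem_nhds (gt_mem_nhds ha)] with t h1 h2
        simp [hout t h1 fun h => absurd h.1 (not_le.2 h2)]
      exact continuousWithinAt_const.congr_of_eventuallyEq h (h.self_of_nhdsWithin (by simp))
    · refine tendsto_const_nhds.congr' ?_
      filter_upwards [Filter.eventually_gt_atTop (max 0 b)] with t ht
      simp [hout t ((le_max_left 0 b).trans ht.le) fun h =>
        absurd h.2 (not_le.2 ((le_max_right 0 b).trans_lt ht))]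
  have i12 : Integrable (fun x => radialTerm V u x - potentialTerm 0 W u x) (vol N) := i1.sub i2
  have i123 : Integrable (fun x => radialTerm V u x - potentialTerm 0 W u x -
    remainderTerm 0 V f u x) (vol N) := i12.sub i3
  rw [integral_add i123 i4, integral_sub i12 i3, integral_sub i1 i2, integral_const_mul] at hzero
  linarith

theorem sphGrad_comp_smul {u : E N → ℝ} (hu : Differentiable ℝ u) (s : ℝ) (x : E N) :
    sphGrad (fun y => u (s • y)) (fun y => u (s • y)) x = sphGrad u u (s • x) := by
  have h : ∀ v, fderiv ℝ (fun y => u (s • y)) x v = fderiv ℝ u (s • x) (s • v) := by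
    intro v
    have h1 : HasFDerivAt (fun y => u (s • y))
        ((fderiv ℝ u (s • x)).comp (s • ContinuousLinearMap.id ℝ (E N))) x :=
      (hu (s • x)).hasFDerivAt.comp x ((hasFDerivAt_id x).const_smul s)
    rw [h1.fderiv]
    simp
  have h2 : ∀ i j, rot i j (fun y => u (s • y)) x = rot i j u (s • x) := by
    intro i j
    rw [rot, h, rot]
    congr 1
    simp only [PiLp.smul_apply, smul_eq_mul]
    module
  simp only [sphGrad, h2]

/-- The angular part dominates the Hardy term: the Poincaré inequality on every sphere about the
pole. -/
theorem integral_hardyTerm_le (hN : 2 ≤ N) {j : ℤ} (hj : -1 ≤ j)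
    (hV : ∀ r ∈ interval R, 0 ≤ V r) (hVc : ContinuousOn V (interval R))
    (hu : u ∈ subspaceH 0 j (ball 0 R \ {0})) :
    ((j : ℝ) + 1) * (N + j - 1) * ∫ x, hardyTerm 0 V u x ∂vol N ≤
      ∫ x, angularTerm V u x ∂vol N := by
  have := nontrivial_E hN
  have hud : Differentiable ℝ u := hu.1.1.differentiable (by simp)
  rw [integral_vol, integral_vol, ← integral_const_mul]
  refine integral_mono_of_spheres
    ((integrable_vol_iff.1 (integrable_hardyTerm hu.1 hVc)).const_mul _)
    (integrable_vol_iff.1 (integrable_angularTerm hu.1 hVc)) fun s hs => ?_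
  have hnorm : ∀ σ : Metric.sphere (0 : E N) 1, ‖s • (σ : E N)‖ = s := fun σ => by
    rw [norm_smul, norm_eq_of_mem_sphere, mul_one, Real.norm_of_nonneg hs.le]
  by_cases hr : Real.arsinh s ∈ interval R
  · have hP := sphere_poincare hN (w := fun y => u (s • y)) (j := j)
      ((hu.1.1.of_le (by simp)).comp (contDiff_id.const_smul s)) hj fun n hn P hPn => by
        have h1 := hu.2 n hn P hPn (Real.arsinh s) hr.1
        simpa only [coeff, polar_zero, Real.sinh_arsinh, evalE] using h1
    simp only [sphGrad_comp_smul hud] at hP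
    have hk : 0 ≤ (√(1 + s ^ 2))⁻¹ * V (Real.arsinh s) / s ^ 2 := by
      have := hV _ hr
      positivity
    have h1 := mul_le_mul_of_nonneg_left hP hk
    rw [mul_left_comm, ← integral_const_mul, ← integral_const_mul, ← integral_const_mul] at h1
    have e1 : ∀ σ : Metric.sphere (0 : E N) 1,
        (height (s • (σ : E N)))⁻¹ * hardyTerm 0 V u (s • (σ : E N)) =
          (√(1 + s ^ 2))⁻¹ * V (Real.arsinh s) / s ^ 2 * u (s • (σ : E N)) ^ 2 := fun σ => by
      rw [hardyTerm, hdist_zero, height, hnorm, Real.sinh_arsinh]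
      ring
    have e2 : ∀ σ : Metric.sphere (0 : E N) 1,
        (height (s • (σ : E N)))⁻¹ * angularTerm V u (s • (σ : E N)) =
          (√(1 + s ^ 2))⁻¹ * V (Real.arsinh s) / s ^ 2 * sphGrad u u (s • (σ : E N)) := fun σ => by
      rw [angularTerm, hdist_zero, height, hnorm]
      ring
    simp only [e1, e2]
    exact h1
  · have hx : ∀ σ : Metric.sphere (0 : E N) 1, s • (σ : E N) ∉ tsupport u := fun σ h => by
      have := (mem_interval_of_mem_tsupport hu.1 h).2
      rw [hdist_zero, hnorm] at this
      exact hr this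
    simp [hardyTerm_eq_zero (hx _), angularTerm_eq_zero (hx _)]

/-- The radial and angular parts are orthogonal. -/
theorem integral_gradTerm (hVc : ContinuousOn V (interval R))
    (hu : IsTestFunction (ball 0 R \ {0}) u) :
    ∫ x, gradTerm 0 V u x ∂vol N =
      (∫ x, radialTerm V u x ∂vol N) + ∫ x, angularTerm V u x ∂vol N := by
  rw [← integral_add (integrable_radialTerm hu hVc) (integrable_angularTerm hu hVc)]
  refine integral_congr_ae (.of_forall fun x => ?_)
  by_cases hx : x ∈ tsupport u
  · simp only [gradTerm, radialTerm, angularTerm, ← mul_add,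
      gradSq_eq_radial_add_angular (hu.1.differentiable (by simp))
        (mem_interval_of_mem_tsupport hu hx).1]
  · simp only [gradTerm_eq_zero hx, radialTerm_eq_zero hx, angularTerm_eq_zero hx, add_zero]

end ZeroPole

/-- The inequality together with the integrability of all its terms, for the pole `p`. -/
def HardyInequality (p : E N) (R : EReal) (V W f : ℝ → ℝ) (j : ℤ) (u : E N → ℝ) : Prop :=
  (IntegrableOn (gradTerm p V u) (ball p R) (vol N) ∧
    IntegrableOn (potentialTerm p W u) (ball p R) (vol N) ∧
    IntegrableOn (hardyTerm p V u) (ball p R) (vol N) ∧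
    IntegrableOn (remainderTerm p V f u) (ball p R) (vol N) ∧
    IntegrableOn (volumeTerm p V f u) (ball p R) (vol N)) ∧
  (∫ x in ball p R, potentialTerm p W u x ∂vol N) +
      ((j : ℝ) + 1) * ((N : ℝ) + j - 1) * (∫ x in ball p R, hardyTerm p V u x ∂vol N) +
      (∫ x in ball p R, remainderTerm p V f u x ∂vol N) -
      ((N : ℝ) - 1) * (∫ x in ball p R, volumeTerm p V f u x ∂vol N) ≤
    ∫ x in ball p R, gradTerm p V u x ∂vol N

theorem hardyInequality_zero (hN : 2 ≤ N) {R : EReal} {V W f : ℝ → ℝ}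
    (hV : ∀ r ∈ interval R, 0 ≤ V r)
    (hVW : IsBesselPair (fun r => r ^ (N - 1) * V r) (fun r => r ^ (N - 1) * W r) R)
    (hf : IsPositiveSolution (fun r => r ^ (N - 1) * V r) (fun r => r ^ (N - 1) * W r) R f)
    {j : ℤ} (hj : -1 ≤ j) {u : E N → ℝ} (hu : u ∈ subspaceH 0 j (ball 0 R \ {0})) :
    HardyInequality 0 R V W f j u := by
  have := nontrivial_E hN
  have hVc := continuousOn_of_pow_mul hVW.1
  have hWc := continuousOn_of_pow_mul hVW.2.1
  have hsub : ∀ x, x ∉ ball 0 R → x ∉ tsupport u := fun x hx h => hx (hu.1.2.2 h).1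
  refine ⟨⟨(integrable_gradTerm hu.1 hVc).integrableOn,
    (integrable_potentialTerm hu.1 hWc).integrableOn,
    (integrable_hardyTerm hu.1 hVc).integrableOn,
    (integrable_remainderTerm hV hVc hWc hf hu.1).integrableOn,
    (integrable_volumeTerm hu.1 hf).integrableOn⟩, ?_⟩
  rw [setIntegral_eq_integral_of_forall_compl_eq_zero fun x hx => gradTerm_eq_zero (hsub x hx),
    setIntegral_eq_integral_of_forall_compl_eq_zero fun x hx => potentialTerm_eq_zero (hsub x hx),
    setIntegral_eq_integral_of_forall_compl_eq_zero fun x hx => hardyTerm_eq_zero (hsub x hx),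
    setIntegral_eq_integral_of_forall_compl_eq_zero fun x hx => remainderTerm_eq_zero (hsub x hx),
    setIntegral_eq_integral_of_forall_compl_eq_zero fun x hx => volumeTerm_eq_zero (hsub x hx),
    integral_gradTerm hVc hu.1, integral_radialTerm hN hV hVc hWc hf hu.1]
  linarith [integral_hardyTerm_le hN hj hV hVc hu]

theorem boost_zero_right (p : E N) : boost p 0 = p := by
  simp [boost_eq, height]

theorem ball_eq_preimage_boost (p : E N) (R : EReal) : ball 0 R = boost p ⁻¹' ball p R := by
  ext y
  simp only [ball, Set.mem_ofPred_eq, Set.mem_preimage, hdist_boost]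

theorem subspaceH_comp_boost {p : E N} {R : EReal} {j : ℤ} {u : E N → ℝ}
    (hu : u ∈ subspaceH p j (ball p R \ {p})) :
    (fun y => u (boost p y)) ∈ subspaceH 0 j (ball 0 R \ {0}) := by
  refine ⟨⟨hu.1.1.comp (contDiff_boost p), hu.1.2.1.comp_homeomorph (boostHomeo p), ?_⟩, ?_⟩
  · have h : tsupport (fun y => u (boost p y)) = boost p ⁻¹' tsupport u :=
      tsupport_comp_eq_preimage u (boostHomeo p)
    rw [h, ball_eq_preimage_boost p]
    intro y hy
    have h1 := hu.1.2.2 (show boost p y ∈ tsupport u from hy)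
    refine ⟨h1.1, fun h2 => h1.2 ?_⟩
    rw [Set.mem_singleton_iff.1 h2, boost_zero_right]
    rfl
  · intro n hn P hP r hr
    rw [← hu.2 n hn P hP r hr]
    refine integral_congr_ae (.of_forall fun σ => ?_)
    simp only [polar_zero, polar_eq_boost p r (norm_eq_of_mem_sphere σ)]

theorem radialDeriv_boost (p : E N) {w : E N → ℝ} {y : E N} (hy : y ≠ 0) :
    radialDeriv p w (boost p y) = radialDeriv 0 (fun z => w (boost p z)) y := by
  have h : ‖‖y‖⁻¹ • y‖ = 1 := by
    rw [norm_smul, norm_inv, norm_norm, inv_mul_cancel₀ (norm_ne_zero_iff.2 hy)]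
  simp only [radialDeriv, hdist_boost, dir_boost, dir_zero, polar_eq_boost p _ h, polar_zero]

/-- At the pole itself `dir` takes the value zero and `polar p · 0` passes through `p` at time `0`. -/
theorem radialDeriv_pole {p : E N} {w : E N → ℝ} (hw : w =ᶠ[nhds p] 0) : radialDeriv p w p = 0 := by
  have h0 : hdist p p = 0 := by
    have := hdist_boost p 0
    rwa [boost_zero_right, hdist_zero, norm_zero, Real.arsinh_zero] at this
  have h1 : Filter.Tendsto (fun t => polar p t (dir p p)) (nhds 0) (nhds p) := by
    have h2 : Continuous fun t => polar p t (dir p p) :=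
      (Real.continuous_cosh.smul continuous_const).add (Real.continuous_sinh.smul continuous_const)
    simpa [polar] using h2.tendsto 0
  have h3 : (fun t => w (polar p t (dir p p))) =ᶠ[nhds 0] fun _ => 0 := h1.eventually hw
  rw [radialDeriv, h0, h3.deriv_eq, deriv_const]

/-- Transport of the inequality by the isometry `boost p`. -/
theorem hardyInequality_of_zero {p : E N} {R : EReal} {V W f : ℝ → ℝ} {j : ℤ}
    {u : E N → ℝ} (hu : Differentiable ℝ u) (hup : u =ᶠ[nhds p] 0)
    (h : HardyInequality 0 R V W f j (fun y => u (boost p y))) : HardyInequality p R V W f j u := by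
  have hemb : MeasurableEmbedding (boost p) := (boostHomeo p).measurableEmbedding
  have hmp := measurePreserving_boost p
  have e0 : gradTerm 0 V (fun y => u (boost p y)) = gradTerm p V u ∘ boost p := by
    funext y
    simp only [gradTerm, Function.comp_apply, hdist_boost, gradSq_comp_boost p hu]
  have e1 : potentialTerm 0 W (fun y => u (boost p y)) = potentialTerm p W u ∘ boost p := by
    funext y
    simp only [potentialTerm, Function.comp_apply, hdist_boost]
  have e2 : hardyTerm 0 V (fun y => u (boost p y)) = hardyTerm p V u ∘ boost p := by
    funext y
    simp only [hardyTerm, Function.comp_apply, hdist_boost]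
  have e4 : volumeTerm 0 V f (fun y => u (boost p y)) = volumeTerm p V f u ∘ boost p := by
    funext y
    simp only [volumeTerm, Function.comp_apply, hdist_boost]
  have e3 : remainderTerm 0 V f (fun y => u (boost p y)) = remainderTerm p V f u ∘ boost p := by
    funext y
    rcases eq_or_ne y 0 with rfl | hy
    · have h1 : (fun z => u z / f (hdist p z)) =ᶠ[nhds p] 0 := by
        filter_upwards [hup] with z hz
        simp [hz]
      have h2 : (fun z => u (boost p z) / f (hdist 0 z)) =ᶠ[nhds 0] 0 := by
        have h3 := (contDiff_boost p).continuous.tendsto 0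
        rw [boost_zero_right] at h3
        filter_upwards [h3.eventually hup] with z hz
        simp [hz]
      rw [Function.comp_apply, boost_zero_right, remainderTerm, remainderTerm, radialDeriv_pole h1,
        radialDeriv_eq_zero h2]
      simp
    · simp only [remainderTerm, Function.comp_apply, hdist_boost, radialDeriv_boost p hy]
  rw [HardyInequality, e0, e1, e2, e3, e4, ball_eq_preimage_boost p] at h
  simp only [hmp.integrableOn_comp_preimage hemb, Function.comp_apply,
    hmp.setIntegral_preimage_emb hemb] at h
  exact h

end Hyp

end

theorem theorem2p1 (N : ℕ) (hN : 2 ≤ N) (x₀ : Hyp.E N) (R : EReal) (hR : 0 < R)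
    (V W f : ℝ → ℝ) (hV : ∀ r ∈ Hyp.interval R, 0 ≤ V r)
    (hVW : Hyp.IsBesselPair (fun r => r ^ (N - 1) * V r) (fun r => r ^ (N - 1) * W r) R)
    (hf : Hyp.IsPositiveSolution (fun r => r ^ (N - 1) * V r) (fun r => r ^ (N - 1) * W r) R f)
    (j : ℤ) (hj : -1 ≤ j)
    (u : Hyp.E N → ℝ) (hu : u ∈ Hyp.subspaceH x₀ j (Hyp.ball x₀ R \ {x₀})) :
    let r : Hyp.E N → ℝ := Hyp.hdist x₀
    let B : Set (Hyp.E N) := Hyp.ball x₀ R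
    let T₀ : Hyp.E N → ℝ := fun x => V (r x) * Hyp.gradSq u x
    let T₁ : Hyp.E N → ℝ := fun x => W (r x) * u x ^ 2
    let T₂ : Hyp.E N → ℝ := fun x => V (r x) * u x ^ 2 / Real.sinh (r x) ^ 2
    let T₃ : Hyp.E N → ℝ := fun x =>
      V (r x) * f (r x) ^ 2 * (Hyp.radialDeriv x₀ (fun z => u z / f (r z)) x) ^ 2
    let T₄ : Hyp.E N → ℝ := fun x =>
      V (r x) * (deriv f (r x) / f (r x)) *
        (Real.cosh (r x) / Real.sinh (r x) - 1 / r x) * u x ^ 2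
    (IntegrableOn T₀ B (Hyp.vol N) ∧ IntegrableOn T₁ B (Hyp.vol N) ∧
      IntegrableOn T₂ B (Hyp.vol N) ∧ IntegrableOn T₃ B (Hyp.vol N) ∧
      IntegrableOn T₄ B (Hyp.vol N)) ∧
    (∫ x in B, T₁ x ∂Hyp.vol N) + ((j : ℝ) + 1) * ((N : ℝ) + j - 1) * (∫ x in B, T₂ x ∂Hyp.vol N)
        + (∫ x in B, T₃ x ∂Hyp.vol N) - ((N : ℝ) - 1) * (∫ x in B, T₄ x ∂Hyp.vol N)
      ≤ ∫ x in B, T₀ x ∂Hyp.vol N :=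
  Hyp.hardyInequality_of_zero (hu.1.1.differentiable (by simp))
    (notMem_tsupport_iff_eventuallyEq.1 fun h => (hu.1.2.2 h).2 rfl)
    (Hyp.hardyInequality_zero hN hV hVW hf hj (Hyp.subspaceH_comp_boost hu))
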